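/- All Lie algebras are real and finite-dimensional. A metric Lie algebra is a Lie algebra $\mathfrak g$ with a non-degenerate symmetric bilinear form $\langle\cdot,\cdot\rangle$ satisfying $\langle[X,Y],Z\rangle=-\langle Y,[X,Z]\rangle$. An orthogonal $\mathfrak l$-module is a finite-dimensional $\mathfrak l$-module $(\rho,\mathfrak a)$ with a non-degenerate symmetric bilinear form $\langle\cdot,\cdot\rangle_{\mathfrak a}$ for which all $\rho(L)$ are skew-symmetric. A subspace is isotropic if the form vanishes on it. A form has signature $(p,q)$ if it has an orthogonal basis consisting of $p$ vectors of square $-1$ and $q$ vectors of square $1$. A Manin pair $(\mathfrak g,\mathfrak h)$ consists of a metric Lie algebra $\mathfrak g$ of signature $(n,n)$ and an $n$-dimensional isotropic subalgebra $\mathfrak h\subset\mathfrak g$; an isomorphism of Manin pairs is an isometric Lie algebra isomorphism which maps the one subalgebra onto the other. For an orthogonal $\mathfrak l$-module $\mathfrak a$, let $\mathcal Z^2_Q(\mathfrak l,\mathfrak a)$ be the set of quadratic cocycles, i.e. of pairs $(\alpha,\gamma)\in \mathrm{Hom}(\bigwedge^2\mathfrak l,\mathfrak a)\oplus \mathrm{Hom}(\bigwedge^3\mathfrak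 l,\mathbb R)$ with $d\alpha=0$ and $d\gamma=\frac12\langle\alpha\wedge\alpha\rangle$, where $d$ is the Chevalley--Eilenberg differential (with coefficients in $\mathfrak a$ and in the trivial module $\mathbb R$, respectively) and $\langle\alpha\wedge\alpha\rangle$ is the wedge product (signed sum over all $(2,2)$-shuffles) followed by $\langle\cdot,\cdot\rangle_{\mathfrak a}$. For $(\alpha,\gamma)\in\mathcal Z^2_Q(\mathfrak l,\mathfrak a)$ let $\mathfrak d_{\alpha,\gamma}(\mathfrak l,\mathfrak a)$ be the metric Lie algebra with underlying vector space $\mathfrak l^*\oplus\mathfrak a\oplus\mathfrak l$, inner product $\langle Z_1+A_1+L_1,Z_2+A_2+L_2\rangle=\langle A_1,A_2\rangle_{\mathfrak a}+Z_1(L_2)+Z_2(L_1)$, and bracket determined by $[\mathfrak l^*,\mathfrak l^*\oplus\mathfrak a]=0$, $[L_1,L_2]=\gamma(L_1,L_2,\cdot)+\alpha(L_1,L_2)+[L_1,L_2]_{\mathfrak l}$, $[L,A]=-\langle A,\alpha(L,\cdot)\rangle_{\mathfrak a}+\rho(L)A$, $[A_1,A_2]=\langle\rho(\cdot)A_1,A_2\rangle_{\mathfrak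 a}$, $[L,Z]=\mathrm{ad}^*(L)Z=-Z\circ\mathrm{ad}(L)$. For a metric Lie algebra $\mathfrak g$ put $R_0(\mathfrak g)=\mathfrak g$ and, for $k\ge1$, let $R_k(\mathfrak g)$ be the smallest ideal of $\mathfrak g$ contained in $R_{k-1}(\mathfrak g)$ such that the $\mathfrak g$-module $R_{k-1}(\mathfrak g)/R_k(\mathfrak g)$ is semisimple. The canonical isotropic ideal is $\mathfrak i(\mathfrak g)=\sum_{k\ge1}R_k(\mathfrak g)\cap R_k(\mathfrak g)^\perp$. We call $\mathfrak d=\mathfrak d_{\alpha,\gamma}(\mathfrak l,\mathfrak a)$ balanced if $\mathfrak i(\mathfrak d)=\mathfrak l^*$. **Proposition.** (1) Let $\mathfrak l$ be a Lie algebra and $\mathfrak l'\subset\mathfrak l$ a subalgebra. Let $\mathfrak a$ be an orthogonal $\mathfrak l$-module of signature $(m,m)$ and $\mathfrak a'\subset\mathfrak a$ an $m$-dimensional isotropic $\mathfrak l'$-invariant subspace. Let $(\alpha,\gamma)\in\mathcal Z^2_Q(\mathfrak l,\mathfrak a)$ satisfy $\alpha(\mathfrak l',\mathfrak l')\subset\mathfrak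 a'$ and $\gamma(\mathfrak l',\mathfrak l',\mathfrak l')=0$. Then $\mathfrak d:=\mathfrak d_{\alpha,\gamma}(\mathfrak l,\mathfrak a)$ has signature $(m+\dim\mathfrak l,m+\dim\mathfrak l)$, and $(\mathfrak d,\mathrm{Ann}(\mathfrak l')\oplus\mathfrak a'\oplus\mathfrak l')$ is a Manin pair, where $\mathrm{Ann}(\mathfrak l')\subset\mathfrak l^*$ is the annihilator of $\mathfrak l'$. (2) Conversely, every Manin pair $(\mathfrak g,\mathfrak h)$ for which $\mathfrak g$ contains no simple (in particular non-abelian) ideals is isomorphic to some pair $(\mathfrak d,\mathrm{Ann}(\mathfrak l')\oplus\mathfrak a'\oplus\mathfrak l')$ constructed as in (1) for which, moreover, $\mathfrak d$ is balanced. -/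

import Mathlib

open LieModule.Cohomology

universe u v w

noncomputable section

namespace QuadExt

/-! ### Inner products and metric Lie algebras -/

/-- An `L`-invariant (possibly indefinite) inner product on an `L`-module `V`: a non-degenerate
symmetric bilinear form for which `L` acts by skew-symmetric maps.  An *orthogonal `L`-module* is an
`L`-module with such an inner product. -/
structure InvariantInnerProduct (L V : Type*) [LieRing L] [AddCommGroup V] [Module ℝ V]
    [LieRingModule L V] where
  form : LinearMap.BilinForm ℝ V
  symm : form.IsSymm
  nondegenerate : form.Nondegenerate
  invariant : form.lieInvariant L

/-- The structure of a *metric Lie algebra* on `g`: a non-degenerate symmetric bilinear form that is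
invariant under the adjoint representation. -/
abbrev MetricStructure (g : Type*) [LieRing g] [LieAlgebra ℝ g] := InvariantInnerProduct g g

/-- `B` has signature `(p, q)`: there is an orthonormal basis with `p` vectors of square `-1` and
`q` vectors of square `1`. -/
def HasSignature {V : Type*} [AddCommGroup V] [Module ℝ V] (B : LinearMap.BilinForm ℝ V)
    (p q : ℕ) : Prop :=
  ∃ b : Module.Basis (Fin p ⊕ Fin q) ℝ V,
    (∀ i j, i ≠ j → B (b i) (b j) = 0) ∧
    (∀ i, B (b (Sum.inl i)) (b (Sum.inl i)) = -1) ∧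
    (∀ j, B (b (Sum.inr j)) (b (Sum.inr j)) = 1)

/-- A subspace on which the form vanishes identically. -/
def IsIsotropic {V : Type*} [AddCommGroup V] [Module ℝ V] (B : LinearMap.BilinForm ℝ V)
    (W : Submodule ℝ V) : Prop :=
  ∀ x ∈ W, ∀ y ∈ W, B x y = 0

/-- `(g, h)` is a *Manin pair*: the metric Lie algebra `g` has signature `(n, n)` and `h` is an
`n`-dimensional isotropic subalgebra. -/
def IsManinPair {g : Type*} [LieRing g] [LieAlgebra ℝ g] (Q : MetricStructure g)
    (h : Submodule ℝ g) : Prop :=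
  ∃ n : ℕ, HasSignature Q.form n n ∧
    (∀ x ∈ h, ∀ y ∈ h, ⁅x, y⁆ ∈ h) ∧ Module.finrank ℝ h = n ∧ IsIsotropic Q.form h

/-- Isomorphism of pairs consisting of a metric Lie algebra and a subspace: an isometric
isomorphism of Lie algebras that maps one subspace onto the other. -/
def IsIsomorphicPair {g₁ g₂ : Type*} [LieRing g₁] [LieAlgebra ℝ g₁] [LieRing g₂] [LieAlgebra ℝ g₂]
    (Q₁ : MetricStructure g₁) (h₁ : Submodule ℝ g₁)
    (Q₂ : MetricStructure g₂) (h₂ : Submodule ℝ g₂) : Prop :=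
  ∃ F : g₁ ≃ₗ⁅ℝ⁆ g₂, (∀ x y, Q₂.form (F x) (F y) = Q₁.form x y) ∧
    h₁.map (F : g₁ →ₗ[ℝ] g₂) = h₂

/-- The Lie algebra `g` contains no ideal which is a simple (in particular non-abelian)
Lie algebra. -/
def HasNoSimpleIdeals (g : Type*) [LieRing g] [LieAlgebra ℝ g] : Prop :=
  ∀ I : LieIdeal ℝ g, ¬ LieAlgebra.IsSimple ℝ I

/-! ### The canonical isotropic ideal -/

/-- A module of a Lie algebra is semisimple if each submodule has a complementary submodule. -/
def IsSemisimpleModule (g M : Type*) [LieRing g] [LieAlgebra ℝ g] [AddCommGroup M] [Module ℝ M]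
    [LieRingModule g M] [LieModule ℝ g M] : Prop :=
  ComplementedLattice (LieSubmodule ℝ g M)

/-- For an ideal `J`, the quotient of `I` by its submodule `J ∩ I`
(so just `I / J` if `J ⊆ I`) is a semisimple `g`-module. -/
def SemisimpleQuotient {g : Type*} [LieRing g] [LieAlgebra ℝ g] (I J : LieIdeal ℝ g) : Prop :=
  IsSemisimpleModule g (I ⧸ LieSubmodule.comap (LieSubmodule.incl I) J)

/-- The chain `g = R₀ ⊇ R₁ ⊇ R₂ ⊇ ...` where `R_{k+1}` is the smallest ideal contained in `R_k` for
which the `g`-module `R_k / R_{k+1}` is semisimple (for finite-dimensional `g` this smallest ideal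
exists, and it is the infimum of all such ideals). -/
def radicalChain (g : Type*) [LieRing g] [LieAlgebra ℝ g] : ℕ → LieIdeal ℝ g
  | 0 => ⊤
  | k + 1 => sInf {J | J ≤ radicalChain g k ∧ SemisimpleQuotient (radicalChain g k) J}

/-- The canonical isotropic ideal `∑_{k ≥ 1} R_k ∩ R_k^⊥` (as a subspace). -/
def canonicalIsotropicIdeal {g : Type*} [LieRing g] [LieAlgebra ℝ g] (Q : MetricStructure g) :
    Submodule ℝ g :=
  ⨆ k : ℕ, (radicalChain g (k + 1)).toSubmodule ⊓
    Q.form.orthogonal (radicalChain g (k + 1)).toSubmodule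

theorem form_comm {L V : Type*} [LieRing L] [AddCommGroup V] [Module ℝ V] [LieRingModule L V]
    (Q : InvariantInnerProduct L V) (x y : V) : Q.form x y = Q.form y x :=
  Q.symm.eq x y

theorem form_lie {L V : Type*} [LieRing L] [AddCommGroup V] [Module ℝ V] [LieRingModule L V]
    (Q : InvariantInnerProduct L V) (x : L) (y z : V) : Q.form ⁅x, y⁆ z = - Q.form y ⁅x, z⁆ :=
  Q.invariant x y z

/-! ### Quadratic cocycles -/

section Cocycle

variable {l : Type u} {a : Type v} [LieRing l] [LieAlgebra ℝ l]
  [AddCommGroup a] [Module ℝ a] [LieRingModule l a] [LieModule ℝ l a]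

/-- The trilinear form `γ` is alternating, i.e. it is a 3-cochain in `C³(l) = Hom(Λ³ l, ℝ)`. -/
def IsAlternating (γ : l →ₗ[ℝ] l →ₗ[ℝ] l →ₗ[ℝ] ℝ) : Prop :=
  (∀ x y, γ x x y = 0) ∧ (∀ x y, γ x y y = 0)

/-- The Chevalley-Eilenberg differential `dγ` of a 3-cochain with trivial real coefficients:
`dγ(x₁,…,x₄) = ∑_{i<j} (-1)^{i+j} γ([x_i, x_j], …)`. -/
def coboundary (γ : l →ₗ[ℝ] l →ₗ[ℝ] l →ₗ[ℝ] ℝ) (x₁ x₂ x₃ x₄ : l) : ℝ :=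
  - γ ⁅x₁, x₂⁆ x₃ x₄ + γ ⁅x₁, x₃⁆ x₂ x₄ - γ ⁅x₁, x₄⁆ x₂ x₃
    - γ ⁅x₂, x₃⁆ x₁ x₄ + γ ⁅x₂, x₄⁆ x₁ x₃ - γ ⁅x₃, x₄⁆ x₁ x₂

/-- The 4-cochain `⟨α ∧ β⟩` of two 2-cochains with values in `a`: the signed sum over all
`(2,2)`-shuffles of the inner products of the values. -/
def innerWedge (Q : InvariantInnerProduct l a) (α β : twoCochain ℝ l a) (x₁ x₂ x₃ x₄ : l) : ℝ :=
  Q.form (α x₁ x₂) (β x₃ x₄) - Q.form (α x₁ x₃) (β x₂ x₄) + Q.form (α x₁ x₄) (β x₂ x₃)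
    + Q.form (α x₂ x₃) (β x₁ x₄) - Q.form (α x₂ x₄) (β x₁ x₃) + Q.form (α x₃ x₄) (β x₁ x₂)

/-- A quadratic 2-cocycle `(α, γ)` of the Lie algebra `l` with coefficients in the orthogonal
`l`-module `a`: `α ∈ C²(l, a)`, `γ ∈ C³(l)`, `dα = 0` and `dγ = ½ ⟨α ∧ α⟩`. -/
structure QuadraticCocycle (Q : InvariantInnerProduct l a) where
  α : twoCochain ℝ l a
  γ : l →ₗ[ℝ] l →ₗ[ℝ] l →ₗ[ℝ] ℝ
  alternating : IsAlternating γ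
  d_α : d₂₃ ℝ l a α = 0
  d_γ : ∀ x₁ x₂ x₃ x₄, coboundary γ x₁ x₂ x₃ x₄ = (1 / 2 : ℝ) * innerWedge Q α α x₁ x₂ x₃ x₄

variable {Q : InvariantInnerProduct l a}

/-! ### The metric Lie algebra `d = l* ⊕ a ⊕ l` of a quadratic cocycle -/

/-- The vector space `l* ⊕ a ⊕ l`, which carries a Lie bracket and an inner product that depend on
the cocycle. -/
def QuadraticCocycle.Model (_c : QuadraticCocycle Q) : Type (max u v) := Module.Dual ℝ l × a × l

namespace QuadraticCocycle

variable (c : QuadraticCocycle Q)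

instance : AddCommGroup c.Model := inferInstanceAs (AddCommGroup (Module.Dual ℝ l × a × l))
instance : Module ℝ c.Model := inferInstanceAs (Module ℝ (Module.Dual ℝ l × a × l))

variable {c}

/-- The component in `l*`. -/
def Model.dualPart : c.Model →ₗ[ℝ] Module.Dual ℝ l := LinearMap.fst ℝ _ _
/-- The component in `a`. -/
def Model.modPart : c.Model →ₗ[ℝ] a := LinearMap.fst ℝ _ _ ∘ₗ LinearMap.snd ℝ _ _
/-- The component in `l`. -/
def Model.algPart : c.Model →ₗ[ℝ] l := LinearMap.snd ℝ _ _ ∘ₗ LinearMap.snd ℝ _ _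

variable (c) in
/-- The element `Z + A + L`. -/
def Model.mk (Z : Module.Dual ℝ l) (A : a) (L : l) : c.Model := (Z, A, L)

@[simp] theorem Model.dualPart_mk (Z : Module.Dual ℝ l) (A : a) (L : l) :
    Model.dualPart (Model.mk c Z A L) = Z := rfl
@[simp] theorem Model.modPart_mk (Z : Module.Dual ℝ l) (A : a) (L : l) :
    Model.modPart (Model.mk c Z A L) = A := rfl
@[simp] theorem Model.algPart_mk (Z : Module.Dual ℝ l) (A : a) (L : l) :
    Model.algPart (Model.mk c Z A L) = L := rfl

theorem Model.ext {X Y : c.Model} (h₁ : ∀ x, X.dualPart x = Y.dualPart x)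
    (h₂ : X.modPart = Y.modPart) (h₃ : X.algPart = Y.algPart) : X = Y :=
  Prod.ext (LinearMap.ext h₁) (Prod.ext h₂ h₃)

/-- The bracket of `Z + A + L` and `Z' + A' + L'`.  The `l`-component is `[L, L']`, the
`a`-component is `α(L, L') + L(A') - L'(A)` and the `l*`-component is
`γ(L, L', ·) - ⟨A', α(L, ·)⟩ + ⟨A, α(L', ·)⟩ + ⟨ρ(·) A, A'⟩ + ad*(L) Z' - ad*(L') Z`. -/
instance : Bracket c.Model c.Model where
  bracket X Y := Model.mk c
    (c.γ X.algPart Y.algPart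
      - Q.form Y.modPart ∘ₗ c.α X.algPart + Q.form X.modPart ∘ₗ c.α Y.algPart
      + Q.form.flip Y.modPart ∘ₗ (LieModule.toEnd ℝ l a : l →ₗ[ℝ] Module.End ℝ a).flip X.modPart
      + ⁅X.algPart, Y.dualPart⁆ - ⁅Y.algPart, X.dualPart⁆)
    (c.α X.algPart Y.algPart + ⁅X.algPart, Y.modPart⁆ - ⁅Y.algPart, X.modPart⁆)
    ⁅X.algPart, Y.algPart⁆

@[simp] theorem Model.algPart_lie (X Y : c.Model) :
    Model.algPart ⁅X, Y⁆ = ⁅X.algPart, Y.algPart⁆ := rfl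

@[simp] theorem Model.modPart_lie (X Y : c.Model) :
    Model.modPart ⁅X, Y⁆ =
      c.α X.algPart Y.algPart + ⁅X.algPart, Y.modPart⁆ - ⁅Y.algPart, X.modPart⁆ := rfl

@[simp] theorem Model.dualPart_lie (X Y : c.Model) (x : l) :
    Model.dualPart ⁅X, Y⁆ x = c.γ X.algPart Y.algPart x
      - Q.form Y.modPart (c.α X.algPart x) + Q.form X.modPart (c.α Y.algPart x)
      + Q.form ⁅x, X.modPart⁆ Y.modPart
      - Y.dualPart ⁅X.algPart, x⁆ + X.dualPart ⁅Y.algPart, x⁆ := by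
  change (_ - _ + _ + _ + - _ - - _ : ℝ) = _
  rw [sub_neg_eq_add, ← sub_eq_add_neg]
  rfl

theorem gamma_swap (c : QuadraticCocycle Q) (x y z : l) : c.γ x y z = - c.γ y x z := by
  have h := c.alternating.1 (x + y) z
  simp only [map_add, LinearMap.add_apply, c.alternating.1] at h
  linarith

theorem gamma_swap' (c : QuadraticCocycle Q) (x y z : l) : c.γ x y z = - c.γ x z y := by
  have h := c.alternating.2 x (y + z)
  simp only [map_add, LinearMap.add_apply, c.alternating.2] at h
  linarith

theorem alpha_jacobi (c : QuadraticCocycle Q) (x y z : l) :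
    ⁅x, c.α y z⁆ - ⁅y, c.α x z⁆ + ⁅z, c.α x y⁆ - c.α ⁅x, y⁆ z + c.α ⁅x, z⁆ y - c.α ⁅y, z⁆ x = 0 := by
  have h := LinearMap.congr_fun (LinearMap.congr_fun (LinearMap.congr_fun c.d_α x) y) z
  simpa using h

instance : LieRing c.Model where
  add_lie X Y W := by
    refine Model.ext (fun x => ?_) ?_ ?_
    · simp; ring
    · simp; abel
    · simp
  lie_add X Y W := by
    refine Model.ext (fun x => ?_) ?_ ?_
    · simp; ring
    · simp; abel
    · simp
  lie_self X := by
    refine Model.ext (fun x => ?_) ?_ ?_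
    · have h : Q.form ⁅x, X.modPart⁆ X.modPart = 0 := by
        have h₁ := form_lie Q x X.modPart X.modPart
        have h₂ := form_comm Q X.modPart ⁅x, X.modPart⁆
        linarith
      simp [h, c.alternating.1]
    · simp
    · simp
  leibniz_lie X Y W := by
    refine Model.ext (fun x => ?_) ?_ ?_
    · have e := c.d_γ X.algPart Y.algPart W.algPart x
      have a₁ := congrArg (Q.form X.modPart) (c.alpha_jacobi Y.algPart W.algPart x)
      have a₂ := congrArg (Q.form Y.modPart) (c.alpha_jacobi X.algPart W.algPart x)
      have a₃ := congrArg (Q.form W.modPart) (c.alpha_jacobi X.algPart Y.algPart x)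
      simp only [coboundary, innerWedge] at e
      simp only [map_add, map_sub, map_zero] at a₁ a₂ a₃
      simp only [Model.dualPart_lie, Model.modPart_lie, Model.algPart_lie, LinearMap.add_apply,
        map_add, map_sub, LinearMap.sub_apply, lie_add, lie_sub, lie_lie]
      generalize X.algPart = p, Y.algPart = q, W.algPart = r, X.modPart = A, Y.modPart = B,
        W.modPart = C at *
      rw [c.gamma_swap p ⁅q, r⁆ x, c.gamma_swap q ⁅p, r⁆ x,
        c.gamma_swap' q r ⁅p, x⁆, c.gamma_swap q ⁅p, x⁆ r,
        c.gamma_swap' p q ⁅r, x⁆, c.gamma_swap p ⁅r, x⁆ q,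
        c.gamma_swap' p r ⁅q, x⁆, c.gamma_swap p ⁅q, x⁆ r]
      rw [← twoCochain_skew c.α ⁅p, x⁆ q, ← twoCochain_skew c.α ⁅p, x⁆ r,
        ← twoCochain_skew c.α ⁅q, x⁆ p, ← twoCochain_skew c.α ⁅q, x⁆ r,
        ← twoCochain_skew c.α ⁅r, x⁆ p, ← twoCochain_skew c.α ⁅r, x⁆ q]
      rw [form_comm Q ⁅x, c.α p q⁆ C]
      rw [form_comm Q (c.α p x), form_comm Q (c.α q x), form_comm Q (c.α r x)] at e
      have b : Q.form B ⁅x, ⁅r, A⁆⁆ = Q.form A ⁅r, ⁅x, B⁆⁆ := by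
        rw [form_comm Q B, form_lie, form_lie, neg_neg]
      simp only [form_lie, map_neg] at *
      linarith
    · have h := c.alpha_jacobi X.algPart Y.algPart W.algPart
      simp only [map_add, Model.modPart_lie, Model.algPart_lie, lie_add, lie_sub, lie_lie]
      generalize X.algPart = p, Y.algPart = q, W.algPart = r at *
      rw [← twoCochain_skew c.α ⁅q, r⁆ p, ← twoCochain_skew c.α ⁅p, r⁆ q, ← sub_eq_zero, ← h]
      abel
    · simp

instance : LieAlgebra ℝ c.Model where
  lie_smul t X Y := by
    refine Model.ext (fun x => ?_) ?_ ?_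
    · simp; ring
    · simp [smul_sub]
    · simp

variable (c)

/-- The inner product
`⟨Z₁ + A₁ + L₁, Z₂ + A₂ + L₂⟩ = ⟨A₁, A₂⟩ + Z₁(L₂) + Z₂(L₁)` on `d`. -/
def modelForm : LinearMap.BilinForm ℝ c.Model :=
  LinearMap.mk₂ ℝ
    (fun X Y => Q.form X.modPart Y.modPart + X.dualPart Y.algPart + Y.dualPart X.algPart)
    (fun X Y W => by simp; ring) (fun t X Y => by simp; ring)
    (fun X Y W => by simp; ring) (fun t X Y => by simp; ring)

@[simp] theorem modelForm_apply (X Y : c.Model) :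
    c.modelForm X Y = Q.form X.modPart Y.modPart + X.dualPart Y.algPart + Y.dualPart X.algPart :=
  rfl

/-- The metric Lie algebra structure on `d`. -/
def modelMetric : MetricStructure c.Model where
  form := c.modelForm
  symm := ⟨fun X Y => by
    simp only [modelForm_apply]
    rw [form_comm Q X.modPart]; ring⟩
  nondegenerate := by
    have key : ∀ X : c.Model, (∀ Y, c.modelForm X Y = 0) → X = 0 := by
      intro X h
      refine Model.ext (fun x => ?_) ?_ ?_
      · simpa using h (Model.mk c 0 0 x)
      · exact Q.nondegenerate.1 _ fun y => by simpa using h (Model.mk c 0 y 0)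
      · exact (Module.forall_dual_apply_eq_zero_iff ℝ _).1
          fun f => by simpa using h (Model.mk c f 0 0)
    refine ⟨key, fun X h => key X fun Y => ?_⟩
    rw [← h Y]
    simp only [modelForm_apply]
    rw [form_comm Q X.modPart]; ring
  invariant X Y W := by
    simp only [modelForm_apply, Model.dualPart_lie, Model.modPart_lie, Model.algPart_lie, map_add,
      map_sub, LinearMap.add_apply, LinearMap.sub_apply]
    have h₁ := c.gamma_swap' X.algPart Y.algPart W.algPart
    have h₂ := form_lie Q X.algPart Y.modPart W.modPart
    have h₃ := form_comm Q W.modPart (c.α X.algPart Y.algPart)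
    have h₄ := form_comm Q Y.modPart ⁅W.algPart, X.modPart⁆
    have h₅ : c.α W.algPart Y.algPart = - c.α Y.algPart W.algPart :=
      (twoCochain_skew c.α _ _).symm
    rw [h₅, ← lie_skew Y.algPart W.algPart]
    simp only [map_neg]
    linarith

/-- The ideal `l*` of `d`. -/
def dualIdeal : Submodule ℝ c.Model :=
  Submodule.prod (⊤ : Submodule ℝ (Module.Dual ℝ l))
    (Submodule.prod (⊥ : Submodule ℝ a) (⊥ : Submodule ℝ l))

/-- `d` is *balanced*: as a quadratic extension of `l` by `a` it is the canonical one, i.e. the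
ideal `l*` is the canonical isotropic ideal of the metric Lie algebra `d`. -/
def IsBalanced : Prop := c.dualIdeal = canonicalIsotropicIdeal c.modelMetric

/-- The subspace `Ann(l') ⊕ a' ⊕ l'` of `d`. -/
def maninSubspace (l' : Submodule ℝ l) (a' : Submodule ℝ a) : Submodule ℝ c.Model :=
  Submodule.prod l'.dualAnnihilator (Submodule.prod a' l')

end QuadraticCocycle

end Cocycle

end QuadExt

end

noncomputable section

namespace QuadExt

/-! ### Irreducible representations -/

section Trace

variable {V : Type*} [AddCommGroup V] [Module ℝ V] [FiniteDimensional ℝ V]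

/-! Part (1) is a direct check. `Ann(l') ⊕ a' ⊕ l'` is closed under the bracket, isotropic, and of
half the dimension; a non-degenerate symmetric form with such an isotropic subspace has split
signature (`hasSignature_of_isIsotropic`).

For part (2) write `i` for the canonical isotropic ideal and take `l = g / i^⊥`, with `a` a copy of
`i^⊥ / i`. Since the `R_k` decrease, the spaces `R_k ∩ R_k^⊥` are mutually orthogonal, so `i ⊆ i^⊥`.
The crux is that `i^⊥ / i` is abelian when `g` has no simple ideals (`lie_mem_canonicalIdeal`), for
two reasons. First, `R₁` acts trivially on irreducible modules, so `[R₁, R_k] ⊆ R_{k+1}`. Indeed `R₁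
⊆ [g, g]`, and `R₁` acts centrally on an irreducible `V` because `g` modulo the centrally acting
elements is semisimple; a trace argument shows that elements of `[g, g]` acting centrally act by
zero. Since `i^⊥ ⊆ R_k + R_k^⊥` for `k ≥ 1`, descent along the chain gives `[R₁, i^⊥] ⊆ i`. Second,
`R₁^⊥` lies in the sum of the minimal ideals, which is abelian: a minimal ideal is isotropic, or
else splits off orthogonally and would be simple if it were not abelian.

Any isotropic section `s` of `g → l` then identifies `g` with `l* ⊕ a ⊕ l`, where `a` is realised as
the orthogonal complement of `l* ⊕ s(l)`, and the components of `[s x, s y]` are the cocycle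
(`IsotropicSplitting.equiv`). Choosing `s` to map the image of `h` into `h` makes `h` the sum of its
three components; this is possible because `h` is its own orthogonal complement. The identification
carries `i` to `l*`, so the model is balanced. -/

theorem eq_zero_of_isIdempotentElem_of_trace_eq_zero {e : Module.End ℝ V}
    (he : IsIdempotentElem e) (ht : LinearMap.trace ℝ V e = 0) : e = 0 := by
  have h := (LinearMap.IsIdempotentElem.isProj_range e he).trace
  rw [ht] at h
  have h0 : Module.finrank ℝ (LinearMap.range e) = 0 := by exact_mod_cast h.symm
  rw [Submodule.finrank_eq_zero] at h0
  exact LinearMap.range_eq_bot.1 h0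

/-- Fitting's decomposition avoids eigenvalues over `ℝ`: the projection onto the part where `φ` is
invertible is a polynomial in `φ` without constant term, so its trace, which is its rank, is zero.
-/
theorem isNilpotent_of_trace_pow_eq_zero {φ : Module.End ℝ V}
    (h : ∀ k : ℕ, LinearMap.trace ℝ V (φ ^ (k + 1)) = 0) : IsNilpotent φ := by
  have htr : ∀ p : Polynomial ℝ,
      LinearMap.trace ℝ V (Polynomial.aeval φ (Polynomial.X * p)) = 0 := by
    intro p
    induction p using Polynomial.induction_on' with
    | add p q hp hq => rw [mul_add, map_add, map_add, hp, hq, add_zero]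
    | monomial n t =>
      rw [Polynomial.X_mul_monomial, Polynomial.aeval_monomial, ← Algebra.smul_def, map_smul, h,
        smul_zero]
  have hne : minpoly ℝ φ ≠ 0 := minpoly.ne_zero (Algebra.IsIntegral.isIntegral φ)
  obtain ⟨q, hq, hndvd⟩ := Polynomial.exists_eq_pow_rootMultiplicity_mul_and_not_dvd _ hne 0
  set n := (minpoly ℝ φ).rootMultiplicity 0
  rw [map_zero, sub_zero] at hq hndvd
  have hcop : IsCoprime (Polynomial.X ^ (n + 1)) q :=
    ((Polynomial.irreducible_X.coprime_iff_not_dvd).2 hndvd).pow_left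
  obtain ⟨a, b, hab⟩ := hcop
  have hzero : Polynomial.aeval φ (Polynomial.X ^ n * q) = 0 := hq ▸ minpoly.aeval ℝ φ
  -- The Fitting projection. The exponent `n + 1` rather than `n` keeps a factor `X` even when `n =
  -- 0`, as the trace hypothesis requires.
  have hidem : IsIdempotentElem (Polynomial.aeval φ (a * Polynomial.X ^ (n + 1))) := by
    have : a * Polynomial.X ^ (n + 1) * (a * Polynomial.X ^ (n + 1))
        = a * Polynomial.X ^ (n + 1) - (Polynomial.X ^ n * q) * (a * b * Polynomial.X) := by
      linear_combination (a * Polynomial.X ^ (n + 1)) * hab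
    rw [IsIdempotentElem, ← map_mul, this, map_sub, map_mul _ (Polynomial.X ^ n * q), hzero,
      zero_mul, sub_zero]
  have he := eq_zero_of_isIdempotentElem_of_trace_eq_zero hidem (by
    rw [pow_succ', mul_left_comm]; exact htr _)
  refine ⟨n, ?_⟩
  have h1 : Polynomial.X ^ n = Polynomial.X ^ n * (a * Polynomial.X ^ (n + 1))
      + (Polynomial.X ^ n * q) * b := by
    linear_combination (-Polynomial.X ^ n : Polynomial ℝ) * hab
  have h2 := congrArg (Polynomial.aeval φ) h1
  rwa [map_add, map_mul, he, mul_zero, map_mul, hzero, zero_mul, add_zero, map_pow,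
    Polynomial.aeval_X] at h2

end Trace

section Irreducible

variable {g : Type*} [LieRing g] [LieAlgebra ℝ g]
  {V : Type*} [AddCommGroup V] [Module ℝ V] [LieRingModule g V] [LieModule ℝ g V]

open LieModule

/-- The trace of `ρ(z) ∘ ψ` vanishes for `z ∈ [g, A]` if `ψ` commutes with `ρ(A)`. -/
theorem trace_toEnd_mul_eq_zero {A : LieIdeal ℝ g} {z : g} (hz : z ∈ ⁅(⊤ : LieIdeal ℝ g), A⁆)
    {ψ : Module.End ℝ V} (hψ : ∀ a ∈ A, Commute (toEnd ℝ g V a) ψ) :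
    LinearMap.trace ℝ V (toEnd ℝ g V z * ψ) = 0 := by
  rw [← LieSubmodule.mem_toSubmodule, LieSubmodule.lieIdeal_oper_eq_linear_span'] at hz
  induction hz using Submodule.span_induction with
  | mem z hz =>
    obtain ⟨x, -, a, ha, rfl⟩ := hz
    have hc : toEnd ℝ g V a * ψ = ψ * toEnd ℝ g V a := hψ a ha
    have hb : toEnd ℝ g V ⁅x, a⁆ = toEnd ℝ g V x * toEnd ℝ g V a - toEnd ℝ g V a * toEnd ℝ g V x :=
      LinearMap.ext fun v => lie_lie x a v
    rw [hb, sub_mul, map_sub, mul_assoc, hc,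
      mul_assoc, LinearMap.trace_mul_comm ℝ (toEnd ℝ g V a), mul_assoc, sub_self]
  | zero => simp
  | add x y _ _ hx hy => rw [map_add, add_mul, map_add, hx, hy, add_zero]
  | smul t x _ hx => rw [map_smul, smul_mul_assoc, map_smul, hx, smul_zero]

/-- All powers of `ρ(z)` commute with `ρ(A)`, so every trace of `ρ(z)^(k+1) = ρ(z) ρ(z)^k` vanishes.
-/
theorem isNilpotent_toEnd_of_mem_lie [FiniteDimensional ℝ V] {A : LieIdeal ℝ g} {z : g}
    (hz : z ∈ ⁅(⊤ : LieIdeal ℝ g), A⁆) (hc : ∀ a ∈ A, ∀ v : V, ⁅⁅a, z⁆, v⁆ = 0) :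
    IsNilpotent (toEnd ℝ g V z) := by
  have hcomm : ∀ a ∈ A, Commute (toEnd ℝ g V a) (toEnd ℝ g V z) := by
    intro a ha
    refine LinearMap.ext fun v => ?_
    have := hc a ha v
    rw [lie_lie, sub_eq_zero] at this
    exact this
  refine isNilpotent_of_trace_pow_eq_zero fun k => ?_
  rw [pow_succ']
  exact trace_toEnd_mul_eq_zero hz fun a ha => (hcomm a ha).pow_right k

variable (V) in
/-- The vectors annihilated by an ideal form a submodule. -/
def annihilatedSubmodule (N : LieIdeal ℝ g) : LieSubmodule ℝ g V where
  carrier := {v | ∀ n ∈ N, ⁅n, v⁆ = 0}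
  add_mem' := fun ha hb n hn => by rw [lie_add, ha n hn, hb n hn, add_zero]
  zero_mem' := fun n _ => lie_zero n
  smul_mem' := fun t v hv n hn => by rw [lie_smul, hv n hn, smul_zero]
  lie_mem := fun {x v} hv n hn => by
    have h : ⁅n, ⁅x, v⁆⁆ = ⁅⁅n, x⁆, v⁆ + ⁅x, ⁅n, v⁆⁆ := by rw [lie_lie]; abel
    rw [h, hv n hn, lie_zero, hv _ (lie_mem_left ℝ g N n x hn), add_zero]

variable [IsIrreducible ℝ g V]

/-- An ideal which acts on an irreducible module by nilpotent maps acts trivially. -/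
theorem lie_eq_zero_of_isNilpotent [FiniteDimensional ℝ g] {N : LieIdeal ℝ g}
    (hN : ∀ n ∈ N, IsNilpotent (toEnd ℝ g V n)) {n : g} (hn : n ∈ N) (v : V) : ⁅n, v⁆ = 0 := by
  have : Nontrivial V := nontrivial_of_isIrreducible ℝ g V
  have : LieModule.IsNilpotent N V :=
    (isNilpotent_iff_forall (R := ℝ)).2 fun x => hN x x.2
  -- Engel: there is a non-zero vector killed by `N`. The vectors killed by `N` form a submodule,
  -- hence everything by irreducibility.
  have := nontrivial_max_triv_of_isNilpotent ℝ N V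
  obtain ⟨w, hw⟩ := exists_ne (0 : maxTrivSubmodule ℝ N V)
  have hw' : (w : V) ∈ annihilatedSubmodule V N := fun n hn =>
    (mem_maxTrivSubmodule ℝ N V _).1 w.2 ⟨n, hn⟩
  have htop : annihilatedSubmodule V N = ⊤ := by
    refine (IsSimpleOrder.eq_bot_or_eq_top _).resolve_left fun h0 => hw ?_
    rw [h0, LieSubmodule.mem_bot] at hw'
    exact Subtype.ext hw'
  have hv : v ∈ annihilatedSubmodule V N := htop ▸ LieSubmodule.mem_top v
  exact hv n hn

/-- An ideal whose commutator acts trivially on an irreducible module acts centrally. -/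
theorem lie_lie_eq_zero_of_abelian [FiniteDimensional ℝ g] [FiniteDimensional ℝ V]
    {A : LieIdeal ℝ g}
    (hA : ∀ a ∈ A, ∀ b ∈ A, ∀ v : V, ⁅⁅a, b⁆, v⁆ = 0) (x : g) {a : g} (ha : a ∈ A) (v : V) :
    ⁅⁅x, a⁆, v⁆ = 0 := by
  refine lie_eq_zero_of_isNilpotent (N := ⁅(⊤ : LieIdeal ℝ g), A⁆) (fun n hn => ?_)
    (LieSubmodule.lie_mem_lie (LieSubmodule.mem_top x) ha) v
  exact isNilpotent_toEnd_of_mem_lie hn fun b hb => hA b hb n (LieSubmodule.lie_le_right _ _ hn)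

/-- An element of `[g, g]` which acts centrally on an irreducible module acts trivially. -/
theorem lie_eq_zero_of_mem_derived [FiniteDimensional ℝ V] {z : g}
    (hz : z ∈ ⁅(⊤ : LieIdeal ℝ g), (⊤ : LieIdeal ℝ g)⁆)
    (hc : ∀ (x : g) (v : V), ⁅⁅x, z⁆, v⁆ = 0) (v : V) : ⁅z, v⁆ = 0 := by
  have : Nontrivial V := nontrivial_of_isIrreducible ℝ g V
  have hnil : IsNilpotent (toEnd ℝ g V z) := isNilpotent_toEnd_of_mem_lie hz fun a _ => hc a
  -- The kernel of a centrally acting element is a submodule; nilpotency makes it non-zero, so it is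
  -- all of `V`.
  let K : LieSubmodule ℝ g V :=
    { LinearMap.ker (toEnd ℝ g V z) with
      lie_mem := fun {x v} hv => by
        have h := hc x v
        have hv' : ⁅z, v⁆ = 0 := hv
        rw [lie_lie, hv', lie_zero, zero_sub, neg_eq_zero] at h
        exact h }
  have hK : K ≠ ⊥ := by
    intro h
    have hinj : Function.Injective (toEnd ℝ g V z) := by
      rw [← LinearMap.ker_eq_bot]
      have : K.toSubmodule = ⊥ := by rw [h]; rfl
      exact this
    obtain ⟨n, hn⟩ := hnil
    have hinjn : Function.Injective ((toEnd ℝ g V z) ^ n) := by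
      rw [Module.End.coe_pow]; exact hinj.iterate n
    obtain ⟨w, hw⟩ := exists_ne (0 : V)
    exact hw (hinjn (by rw [hn]; rfl))
  have hv : v ∈ K := ((IsSimpleOrder.eq_bot_or_eq_top K).resolve_left hK) ▸ LieSubmodule.mem_top v
  exact hv

end Irreducible

/-! ### The chain `R_k` through maximal submodules -/

section Coatoms

variable {g : Type*} [LieRing g]
  {V : Type*} [AddCommGroup V] [Module ℝ V] [LieRingModule g V]
  {W : Type*} [AddCommGroup W] [Module ℝ W] [LieRingModule g W]

theorem isCoatom_comap {f : V →ₗ⁅ℝ, g⁆ W} (hf : Function.Surjective f) {N : LieSubmodule ℝ g W}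
    (hN : IsCoatom N) : IsCoatom (N.comap f) := by
  refine ⟨fun h => hN.1 ?_, fun b hb => ?_⟩
  · rw [eq_top_iff]
    intro y _
    obtain ⟨x, rfl⟩ := hf y
    have : x ∈ N.comap f := h ▸ LieSubmodule.mem_top x
    exact this
  · have hlt : N < b.map f := by
      refine lt_of_le_of_ne (fun y hy => ?_) fun h => ?_
      · obtain ⟨x, rfl⟩ := hf y
        exact LieSubmodule.mem_map_of_mem (hb.le hy)
      · refine hb.not_ge ?_
        rw [h]
        exact LieSubmodule.map_le_iff_le_comap.1 le_rfl
    have htop := hN.2 _ hlt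
    rw [eq_top_iff]
    intro x _
    have hx : f x ∈ b.map f := htop ▸ LieSubmodule.mem_top _
    obtain ⟨y, hy, hxy⟩ := (LieSubmodule.mem_map _).1 hx
    have hker : x - y ∈ N.comap f := by
      rw [LieSubmodule.mem_comap, map_sub, hxy, sub_self]
      exact N.zero_mem
    have := b.add_mem (hb.le hker) hy
    rwa [sub_add_cancel] at this

theorem map_incl_covBy {I : LieSubmodule ℝ g V} {N : LieSubmodule ℝ g I} (hN : IsCoatom N) :
    N.map I.incl ⋖ I := by
  refine ⟨lt_of_le_of_ne ?_ fun h => hN.1 ?_, fun b hb hbI => ?_⟩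
  · rintro _ ⟨x, -, rfl⟩
    exact x.2
  · rw [eq_top_iff]
    rintro ⟨x, hx⟩ -
    rw [← h] at hx
    obtain ⟨y, hy, rfl⟩ := (LieSubmodule.mem_map _).1 hx
    exact hy
  · have htop : b.comap I.incl = ⊤ := by
      refine hN.2 _ (lt_of_le_of_ne (fun x hx => hb.le (LieSubmodule.mem_map_of_mem hx)) ?_)
      intro h
      refine hb.not_ge fun x hx => ?_
      have : (⟨x, hbI.le hx⟩ : I) ∈ N := by rw [h]; exact hx
      exact (LieSubmodule.mem_map _).2 ⟨_, this, rfl⟩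
    refine hbI.not_ge fun x hx => ?_
    have : (⟨x, hx⟩ : I) ∈ b.comap I.incl := htop ▸ LieSubmodule.mem_top _
    exact this

theorem isCoatom_comap_incl {I M : LieSubmodule ℝ g V} (h : M ⋖ I) :
    IsCoatom (M.comap I.incl) := by
  refine ⟨fun ht => h.lt.not_ge fun x hx => ?_, fun b hb => ?_⟩
  · have : (⟨x, hx⟩ : I) ∈ M.comap I.incl := ht ▸ LieSubmodule.mem_top _
    exact this
  · by_contra hne
    refine h.2 (c := b.map I.incl) (lt_of_le_of_ne (fun x hx => ?_) ?_)
      (lt_of_le_of_ne ?_ fun hbI => hne ?_)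
    · exact (LieSubmodule.mem_map _).2 ⟨⟨x, h.le hx⟩, hb.le hx, rfl⟩
    · intro hM
      refine hb.not_ge fun x hx => ?_
      have : (x : V) ∈ b.map I.incl := LieSubmodule.mem_map_of_mem hx
      rw [← hM] at this
      exact this
    · rintro _ ⟨x, -, rfl⟩
      exact x.2
    · rw [eq_top_iff]
      rintro ⟨x, hx⟩ -
      have hx' := hx
      rw [← hbI] at hx'
      obtain ⟨y, hy, rfl⟩ := (LieSubmodule.mem_map _).1 hx'
      exact hy

/-- In a semisimple module the maximal submodules intersect in zero. This is the dual form of being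
a sum of simple submodules, so atomisticity is applied to the opposite lattice. -/
theorem exists_isCoatom_notMem [FiniteDimensional ℝ V] [ComplementedLattice (LieSubmodule ℝ g V)]
    {v : V} (hv : v ≠ 0) : ∃ N : LieSubmodule ℝ g V, IsCoatom N ∧ v ∉ N := by
  have : WellFoundedLT (LieSubmodule ℝ g V) := LieSubmodule.wellFoundedLT_of_isArtinian ℝ g V
  have : IsCompactlyGenerated (LieSubmodule ℝ g V)ᵒᵈ :=
    CompleteLattice.isCompactlyGenerated_of_wellFoundedGT
  have : IsAtomistic (LieSubmodule ℝ g V)ᵒᵈ := inferInstance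
  have : IsCoatomistic (LieSubmodule ℝ g V) := isAtomistic_dual_iff_isCoatomistic.1 this
  obtain ⟨s, hs, hs'⟩ := eq_sInf_coatoms (⊥ : LieSubmodule ℝ g V)
  by_contra! h
  refine hv ((LieSubmodule.mem_bot (R := ℝ) (L := g) v).1 ?_)
  rw [hs, ← SetLike.mem_coe, LieSubmodule.coe_sInf, Set.mem_iInter₂]
  exact fun N hN => h N (hs' N hN)

variable [LieAlgebra ℝ g] [LieModule ℝ g V]

theorem isIrreducible_quotient {N : LieSubmodule ℝ g V} (hN : IsCoatom N) :
    LieModule.IsIrreducible ℝ g (V ⧸ N) := by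
  have : Nontrivial (V ⧸ N) := by
    refine Submodule.Quotient.nontrivial_iff.2 fun h => hN.1 ?_
    exact (LieSubmodule.toSubmodule_eq_top N).1 h
  refine LieModule.IsIrreducible.mk fun P hP => ?_
  have hle : N ≤ P.comap (LieSubmodule.Quotient.mk' N) := fun x hx => by
    rw [LieSubmodule.mem_comap, (LieSubmodule.Quotient.mk_eq_zero (N := N)).2 hx]
    exact P.zero_mem
  have htop := hN.2 _ (lt_of_le_of_ne hle fun h => hP ?_)
  · rw [eq_top_iff]
    intro y _
    obtain ⟨x, rfl⟩ := LieSubmodule.Quotient.surjective_mk' N y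
    have : x ∈ P.comap (LieSubmodule.Quotient.mk' N) := htop ▸ LieSubmodule.mem_top x
    exact this
  · rw [eq_bot_iff]
    intro y hy
    obtain ⟨x, rfl⟩ := LieSubmodule.Quotient.surjective_mk' N y
    have : x ∈ N := by rw [h]; exact hy
    rw [LieSubmodule.mem_bot]
    exact (LieSubmodule.Quotient.mk_eq_zero _).2 this

end Coatoms

/-! ### The ideals `R_k` as successive intersections of maximal submodules -/

section Chain

variable {g : Type*} [LieRing g] [LieAlgebra ℝ g]

theorem semisimpleQuotient_self (I : LieIdeal ℝ g) : SemisimpleQuotient I I := by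
  have h : ∀ x : I ⧸ LieSubmodule.comap (LieSubmodule.incl I) I, x = 0 := fun x => by
    obtain ⟨y, rfl⟩ := LieSubmodule.Quotient.surjective_mk' _ x
    exact (LieSubmodule.Quotient.mk_eq_zero _).2 y.2
  have : Subsingleton (LieSubmodule ℝ g (I ⧸ LieSubmodule.comap (LieSubmodule.incl I) I)) :=
    ⟨fun P P' => LieSubmodule.ext _ _ fun x => by rw [h x]; simp⟩
  exact ⟨fun P => ⟨P, disjoint_iff.2 (Subsingleton.elim _ _),
    codisjoint_iff.2 (Subsingleton.elim _ _)⟩⟩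

theorem semisimpleQuotient_of_covBy {I J : LieIdeal ℝ g} (h : J ⋖ I) : SemisimpleQuotient I J := by
  have := isIrreducible_quotient (isCoatom_comap_incl h)
  exact (inferInstance :
    ComplementedLattice (LieSubmodule ℝ g (I ⧸ LieSubmodule.comap (LieSubmodule.incl I) J)))

variable [FiniteDimensional ℝ g]

theorem exists_covBy_notMem {I J : LieIdeal ℝ g} (h : SemisimpleQuotient I J) {x : g} (hxI : x ∈ I)
    (hxJ : x ∉ J) : ∃ M, M ⋖ I ∧ x ∉ M := by
  have : ComplementedLattice (LieSubmodule ℝ g (I ⧸ LieSubmodule.comap (LieSubmodule.incl I) J)) := h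
  have hne : LieSubmodule.Quotient.mk' (LieSubmodule.comap (LieSubmodule.incl I) J) ⟨x, hxI⟩ ≠ 0 :=
    fun h0 =>
    hxJ ((LieSubmodule.Quotient.mk_eq_zero
      (LieSubmodule.comap (LieSubmodule.incl I) J)).1 h0)
  have : FiniteDimensional ℝ (I ⧸ LieSubmodule.comap (LieSubmodule.incl I) J) :=
    inferInstanceAs (FiniteDimensional ℝ (I ⧸ (LieSubmodule.comap (LieSubmodule.incl I) J).toSubmodule))
  obtain ⟨N, hN, hxN⟩ := exists_isCoatom_notMem (g := g) hne
  refine ⟨_, map_incl_covBy (isCoatom_comap (LieSubmodule.Quotient.surjective_mk' _) hN), ?_⟩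
  intro hx
  obtain ⟨y, hy, hxy⟩ := (LieSubmodule.mem_map _).1 hx
  have : y = ⟨x, hxI⟩ := Subtype.ext hxy
  exact hxN (this ▸ hy)

/-- `R_{k+1}` is the intersection of the maximal submodules of `R_k`. -/
theorem mem_radicalChain_succ {k : ℕ} {x : g} : x ∈ radicalChain g (k + 1) ↔
    x ∈ radicalChain g k ∧ ∀ M : LieIdeal ℝ g, M ⋖ radicalChain g k → x ∈ M := by
  change x ∈ sInf _ ↔ _
  rw [← SetLike.mem_coe, LieSubmodule.coe_sInf, Set.mem_iInter₂]
  refine ⟨fun h => ⟨h _ ⟨le_rfl, semisimpleQuotient_self _⟩,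
    fun M hM => h M ⟨hM.le, semisimpleQuotient_of_covBy hM⟩⟩, fun ⟨h, h'⟩ J hJ => ?_⟩
  by_contra hxJ
  obtain ⟨M, hM, hxM⟩ := exists_covBy_notMem hJ.2 h hxJ
  exact hxM (h' M hM)

theorem radicalChain_succ_le (k : ℕ) : radicalChain g (k + 1) ≤ radicalChain g k :=
  fun _ hx => (mem_radicalChain_succ.1 hx).1

theorem radicalChain_antitone : Antitone (radicalChain g) :=
  antitone_nat_of_succ_le radicalChain_succ_le

theorem radicalChain_succ_le_of_covBy {k : ℕ} {M : LieIdeal ℝ g} (h : M ⋖ radicalChain g k) :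
    radicalChain g (k + 1) ≤ M := fun _ hx => (mem_radicalChain_succ.1 hx).2 M h

theorem mem_of_mem_radicalChain_one {x : g} (hx : x ∈ radicalChain g 1) {M : LieIdeal ℝ g}
    (hM : IsCoatom M) : x ∈ M :=
  radicalChain_succ_le_of_covBy (k := 0) (covBy_top_iff.2 hM) hx

/-- A non-zero finite-dimensional module has a maximal submodule, which contains `R_{k+1}`. Hence
the chain reaches zero. -/
theorem radicalChain_succ_lt {k : ℕ} (h : radicalChain g k ≠ ⊥) :
    radicalChain g (k + 1) < radicalChain g k := by
  have : IsCoatomic (LieSubmodule ℝ g (radicalChain g k)) :=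
    isCoatomic_of_orderTop_gt_wellFounded (LieSubmodule.wellFoundedGT_of_noetherian ℝ g _).wf
  have : Nontrivial (LieSubmodule ℝ g (radicalChain g k)) := by
    rw [LieSubmodule.nontrivial_iff]
    exact (LieSubmodule.nontrivial_iff_ne_bot ℝ g g).2 h
  obtain ⟨N, hN⟩ := IsCoatomic.exists_coatom (LieSubmodule ℝ g (radicalChain g k))
  have hM := map_incl_covBy hN
  exact (radicalChain_succ_le_of_covBy hM).trans_lt hM.lt

theorem exists_radicalChain_eq_bot : ∃ n, radicalChain g n = ⊥ := by
  by_contra! h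
  have hwf : WellFoundedLT (LieIdeal ℝ g) := LieSubmodule.wellFoundedLT_of_isArtinian ℝ g g
  obtain ⟨_, ⟨n, rfl⟩, hn⟩ := hwf.wf.has_min _ (Set.range_nonempty (radicalChain g))
  exact hn _ ⟨n + 1, rfl⟩ (radicalChain_succ_lt (h n))

end Chain

/-! ### The action of `R₁` on semisimple modules -/

section RadicalAction

variable {g : Type*} [LieRing g] [LieAlgebra ℝ g]

section
variable (V : Type*) [AddCommGroup V] [Module ℝ V] [LieRingModule g V] [LieModule ℝ g V]

/-- The ideal of all elements which act on a module by operators commuting with the action. -/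
def centralActionIdeal : LieIdeal ℝ g where
  carrier := {x | ∀ (y : g) (v : V), ⁅⁅y, x⁆, v⁆ = 0}
  add_mem' := fun ha hb y v => by rw [lie_add, add_lie, ha, hb, add_zero]
  zero_mem' := fun y v => by rw [lie_zero, zero_lie]
  smul_mem' := fun t x hx y v => by rw [lie_smul, smul_lie, hx, smul_zero]
  lie_mem := fun {z x} hx y v => by
    rw [lie_lie y, hx z v, lie_zero, hx z, sub_zero]

end

/-- The `g`-submodules of `g / I` are the ideals of `g / I`. -/
def quotientIdealIso (I : LieIdeal ℝ g) : LieSubmodule ℝ g (g ⧸ I) ≃o LieIdeal ℝ (g ⧸ I) where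
  toFun N :=
    { N.toSubmodule with
      lie_mem := fun {x y} hy => by
        obtain ⟨x, rfl⟩ := LieSubmodule.Quotient.surjective_mk' I x
        exact N.lie_mem (x := x) hy }
  invFun N :=
    { N.toSubmodule with
      lie_mem := fun {x y} hy => N.lie_mem (x := LieSubmodule.Quotient.mk' I x) hy }
  left_inv _ := rfl
  right_inv _ := rfl
  map_rel_iff' := Iff.rfl

variable [FiniteDimensional ℝ g]

/-- Every hyperplane containing `[g, g]` is a maximal ideal, and such hyperplanes separate `[g, g]`
from any point outside it. -/
theorem radicalChain_one_le_derived :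
    radicalChain g 1 ≤ ⁅(⊤ : LieIdeal ℝ g), (⊤ : LieIdeal ℝ g)⁆ := by
  intro x hx
  by_contra hxd
  obtain ⟨f, hfx, hf⟩ := Submodule.exists_dual_map_eq_bot_of_notMem
    (p := (⁅(⊤ : LieIdeal ℝ g), (⊤ : LieIdeal ℝ g)⁆ : LieIdeal ℝ g).toSubmodule) hxd inferInstance
  have hfd : ∀ y z : g, f ⁅y, z⁆ = 0 := fun y z => by
    have h : f ⁅y, z⁆ ∈ Submodule.map f
        (⁅(⊤ : LieIdeal ℝ g), (⊤ : LieIdeal ℝ g)⁆ : LieIdeal ℝ g).toSubmodule :=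
      Submodule.mem_map_of_mem
        (LieSubmodule.lie_mem_lie (LieSubmodule.mem_top y) (LieSubmodule.mem_top z))
    rwa [hf, Submodule.mem_bot] at h
  let H : LieIdeal ℝ g := { LinearMap.ker f with lie_mem := fun {y z} _ => hfd y z }
  have hH : IsCoatom H := by
    refine ⟨fun h => hfx ?_, fun b hb => ?_⟩
    · have : x ∈ H := h ▸ LieSubmodule.mem_top x
      exact this
    · obtain ⟨y, hyb, hyH⟩ := SetLike.exists_of_lt hb
      have hy : f y ≠ 0 := hyH
      rw [eq_top_iff]
      intro z _
      have hz : z - (f z / f y) • y ∈ H := by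
        change f _ = 0
        rw [map_sub, map_smul, smul_eq_mul, div_mul_cancel₀ _ hy, sub_self]
      have := b.add_mem (hb.le hz) (b.smul_mem (f z / f y) hyb)
      rwa [sub_add_cancel] at this
  have : x ∈ H := mem_of_mem_radicalChain_one hx hH
  exact hfx this

section
variable (V : Type*) [AddCommGroup V] [Module ℝ V] [LieRingModule g V] [LieModule ℝ g V]
  [FiniteDimensional ℝ V] [LieModule.IsIrreducible ℝ g V]

/-- The brackets of elements of `A` lie in `[g, g]` and act centrally, hence by zero; so the image
of `A` in `End V` is abelian, and therefore central. -/
theorem mem_centralActionIdeal_of_abelian {A : LieIdeal ℝ g}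
    (hA : ∀ a ∈ A, ∀ b ∈ A, ⁅a, b⁆ ∈ centralActionIdeal V) {a : g} (ha : a ∈ A) :
    a ∈ centralActionIdeal V := by
  refine fun y v => lie_lie_eq_zero_of_abelian (V := V) (A := A) (fun b hb c hc v => ?_) y ha v
  exact lie_eq_zero_of_mem_derived
    (LieSubmodule.lie_mem_lie (LieSubmodule.mem_top b) (LieSubmodule.mem_top c)) (hA b hb c hc) v

/-- The preimage of an abelian ideal has its brackets in the central-action ideal, so it lies in
that ideal itself. -/
instance hasTrivialRadical_quotient_centralActionIdeal :
    LieAlgebra.HasTrivialRadical ℝ (g ⧸ (centralActionIdeal V : LieIdeal ℝ g)) := by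
  rw [LieAlgebra.hasTrivialRadical_iff_no_abelian_ideals]
  intro I hI
  let f := LieSubmodule.Quotient.mk' (centralActionIdeal V : LieIdeal ℝ g)
  have hf : ∀ x y : g, f ⁅x, y⁆ = ⁅f x, f y⁆ := LieSubmodule.Quotient.mk_bracket _
  let A : LieIdeal ℝ g :=
    { I.toSubmodule.comap (f : g →ₗ[ℝ] _) with
      lie_mem := fun {x a} ha => by
        change f ⁅x, a⁆ ∈ I
        rw [hf]
        exact lie_mem_right ℝ _ I _ _ ha }
  have hA : ∀ a ∈ A, ∀ b ∈ A, ⁅a, b⁆ ∈ (centralActionIdeal V : LieIdeal ℝ g) := by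
    intro a ha b hb
    refine (LieSubmodule.Quotient.mk_eq_zero _).1 ((hf a b).trans ?_)
    have h := hI.trivial ⟨f a, ha⟩ ⟨f b, hb⟩
    exact congrArg Subtype.val h
  rw [eq_bot_iff]
  intro y hy
  obtain ⟨x, rfl⟩ := LieSubmodule.Quotient.surjective_mk' _ y
  rw [LieSubmodule.mem_bot]
  exact (LieSubmodule.Quotient.mk_eq_zero _).2 (mem_centralActionIdeal_of_abelian V hA hy)

/-- The quotient is semisimple, so its maximal ideals intersect in zero, and their preimages are
maximal ideals of `g`. -/
theorem radicalChain_one_le_centralActionIdeal : radicalChain g 1 ≤ centralActionIdeal V := by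
  intro x hx
  by_contra hxC
  let f := LieSubmodule.Quotient.mk' (centralActionIdeal V : LieIdeal ℝ g)
  have hne : f x ≠ 0 := fun h => hxC ((LieSubmodule.Quotient.mk_eq_zero _).1 h)
  have hfd : FiniteDimensional ℝ (g ⧸ (centralActionIdeal V : LieIdeal ℝ g)) :=
    inferInstanceAs (FiniteDimensional ℝ (g ⧸ (centralActionIdeal V : LieIdeal ℝ g).toSubmodule))
  have hss : LieAlgebra.IsSemisimple ℝ (g ⧸ (centralActionIdeal V : LieIdeal ℝ g)) := inferInstance
  have hcl := (quotientIdealIso (centralActionIdeal V : LieIdeal ℝ g)).symm.complementedLattice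
  obtain ⟨N, hN, hxN⟩ := exists_isCoatom_notMem (g := g) hne
  exact hxN (mem_of_mem_radicalChain_one hx
    (isCoatom_comap (LieSubmodule.Quotient.surjective_mk' _) hN))

/-- `R₁` acts trivially on irreducible modules. -/
theorem lie_eq_zero_of_mem_radicalChain_one {x : g} (hx : x ∈ radicalChain g 1) (v : V) :
    ⁅x, v⁆ = 0 :=
  lie_eq_zero_of_mem_derived (radicalChain_one_le_derived hx)
    (radicalChain_one_le_centralActionIdeal V hx) v

end

/-- `R₁` acts by zero on each irreducible quotient `R_k / M` with `M` maximal in `R_k`. -/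
theorem lie_mem_radicalChain_succ {k : ℕ} {x y : g} (hx : x ∈ radicalChain g 1)
    (hy : y ∈ radicalChain g k) : ⁅x, y⁆ ∈ radicalChain g (k + 1) := by
  refine mem_radicalChain_succ.2 ⟨lie_mem_right ℝ g _ x y hy, fun M hM => ?_⟩
  have hco := isCoatom_comap_incl hM
  have hirr := isIrreducible_quotient hco
  set N := LieSubmodule.comap (LieSubmodule.incl (radicalChain g k)) M
  have hfd : FiniteDimensional ℝ (radicalChain g k ⧸ N) :=
    inferInstanceAs (FiniteDimensional ℝ (radicalChain g k ⧸ N.toSubmodule))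
  have h := lie_eq_zero_of_mem_radicalChain_one (radicalChain g k ⧸ N) hx
    (LieSubmodule.Quotient.mk' N ⟨y, hy⟩)
  rw [← LieModuleHom.map_lie, LieSubmodule.Quotient.mk_eq_zero] at h
  exact h

end RadicalAction

/-! ### The canonical isotropic ideal -/

section Metric

variable {g : Type*} [LieRing g] [LieAlgebra ℝ g] (Q : MetricStructure g)

/-- The orthogonal complement of an ideal. -/
def perp (I : LieIdeal ℝ g) : LieIdeal ℝ g :=
  LieAlgebra.InvariantForm.orthogonal Q.form Q.invariant I

variable {Q}

theorem mem_perp {I : LieIdeal ℝ g} {y : g} : y ∈ perp Q I ↔ ∀ x ∈ I, Q.form x y = 0 :=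
  LieAlgebra.InvariantForm.mem_orthogonal _ _ _ _

theorem perp_antitone : Antitone (perp Q) :=
  fun _ _ h _ hy => mem_perp.2 fun x hx => mem_perp.1 hy x (h hx)

theorem perp_sup (I J : LieIdeal ℝ g) : perp Q (I ⊔ J) = perp Q I ⊓ perp Q J := by
  refine le_antisymm (le_inf (perp_antitone le_sup_left) (perp_antitone le_sup_right)) ?_
  intro y hy
  refine mem_perp.2 fun x hx => ?_
  obtain ⟨a, ha, b, hb, rfl⟩ := (LieSubmodule.mem_sup _ _ _).1 hx
  rw [map_add, LinearMap.add_apply, mem_perp.1 hy.1 a ha, mem_perp.1 hy.2 b hb, add_zero]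

theorem lie_eq_zero_of_forall_form {x y : g} (h : ∀ z, Q.form y ⁅x, z⁆ = 0) : ⁅x, y⁆ = 0 :=
  Q.nondegenerate.1 _ fun z => by rw [form_lie, h, neg_zero]

variable (Q) in
/-- The canonical isotropic ideal as a Lie ideal. -/
def canonicalIdeal : LieIdeal ℝ g :=
  ⨆ k : ℕ, radicalChain g (k + 1) ⊓ perp Q (radicalChain g (k + 1))

theorem canonicalIdeal_toSubmodule :
    (canonicalIdeal Q).toSubmodule = canonicalIsotropicIdeal Q := by
  rw [canonicalIdeal, LieSubmodule.iSup_toSubmodule]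
  rfl

theorem mem_perp_canonicalIdeal {y : g} : y ∈ perp Q (canonicalIdeal Q) ↔
    ∀ k, ∀ x ∈ radicalChain g (k + 1), x ∈ perp Q (radicalChain g (k + 1)) → Q.form x y = 0 := by
  refine ⟨fun h k x hx hx' => mem_perp.1 h x (LieSubmodule.mem_iSup_of_mem k ⟨hx, hx'⟩),
    fun h => mem_perp.2 fun x hx => ?_⟩
  have hle : (canonicalIdeal Q).toSubmodule ≤ LinearMap.ker (Q.form.flip y) := by
    rw [canonicalIdeal, LieSubmodule.iSup_toSubmodule]
    exact iSup_le fun k x hx => h k x hx.1 hx.2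
  exact hle hx

variable [FiniteDimensional ℝ g]

theorem perp_perp (I : LieIdeal ℝ g) : perp Q (perp Q I) = I := by
  rw [← LieSubmodule.toSubmodule_inj]
  exact LinearMap.BilinForm.orthogonal_orthogonal Q.nondegenerate Q.symm.isRefl I.toSubmodule

theorem perp_inf (I J : LieIdeal ℝ g) : perp Q (I ⊓ J) = perp Q I ⊔ perp Q J := by
  rw [← perp_perp (perp Q I ⊔ perp Q J), perp_sup, perp_perp, perp_perp]

theorem perp_le_iff {I J : LieIdeal ℝ g} : perp Q I ≤ J ↔ perp Q J ≤ I :=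
  ⟨fun h => (perp_antitone h).trans (perp_perp I).le,
    fun h => (perp_antitone h).trans (perp_perp J).le⟩

theorem isAtom_perp {M : LieIdeal ℝ g} (hM : IsCoatom M) : IsAtom (perp Q M) := by
  refine ⟨fun h => hM.1 ?_, fun b hb => ?_⟩
  · rw [← perp_perp (Q := Q) M, h, eq_top_iff]
    intro y _
    refine mem_perp.2 fun x hx => ?_
    rw [(LieSubmodule.mem_bot x).1 hx, map_zero, LinearMap.zero_apply]
  · have hlt : M < perp Q b := by
      refine lt_of_le_of_ne ?_ fun h => ?_
      · rw [← perp_perp (Q := Q) M]; exact perp_antitone hb.le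
      · rw [h, perp_perp] at hb
        exact hb.ne rfl
    have htop := hM.2 _ hlt
    rw [eq_bot_iff]
    intro y hy
    refine (LieSubmodule.mem_bot y).2 (Q.nondegenerate.1 _ fun z => ?_)
    exact mem_perp.1 (htop ▸ LieSubmodule.mem_top z : z ∈ perp Q b) y hy

/-- By minimality `M ∩ M^⊥` is `0` or `M`. If it is `0`, then `g = M ⊕ M^⊥` with commuting summands,
so ideals of `M` are ideals of `g`, and a non-abelian `M` would be simple. If it is `M`, invariance
gives `⟨[x, y], z⟩ = -⟨y, [x, z]⟩ = 0`. -/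
theorem lie_eq_zero_of_isAtom (hg : HasNoSimpleIdeals g) (Q : MetricStructure g) {M : LieIdeal ℝ g}
    (hM : IsAtom M) {x y : g} (hx : x ∈ M) (hy : y ∈ M) : ⁅x, y⁆ = 0 := by
  rcases (hM.le_iff.1 (inf_le_left : M ⊓ perp Q M ≤ M)) with h | h
  · by_contra hxy
    have hsup : M ⊔ perp Q M = ⊤ := by
      rw [← perp_perp (Q := Q) M, ← perp_inf, perp_perp, inf_comm, h, eq_top_iff]
      intro y _
      refine mem_perp.2 fun x hx => ?_
      rw [(LieSubmodule.mem_bot x).1 hx, map_zero, LinearMap.zero_apply]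
    refine hg M ⟨fun I => ?_, fun hab => hxy ?_⟩
    · let J : LieIdeal ℝ g :=
        { I.toSubmodule.map M.toSubmodule.subtype with
          lie_mem := fun {u v} hv => by
            obtain ⟨w, hw, rfl⟩ := hv
            obtain ⟨a, ha, b, hb, rfl⟩ := (LieSubmodule.mem_sup _ _ _).1
              (hsup ▸ LieSubmodule.mem_top u : u ∈ M ⊔ perp Q M)
            have hb0 : ⁅b, (w : g)⁆ = 0 := by
              rw [← LieSubmodule.mem_bot (R := ℝ) (L := g), ← h]
              exact ⟨lie_mem_right ℝ g M _ _ w.2, lie_mem_left ℝ g (perp Q M) _ _ hb⟩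
            refine ⟨⁅(⟨a, ha⟩ : M), w⁆, lie_mem_right ℝ M I _ _ hw, ?_⟩
            change ⁅a, (w : g)⁆ = ⁅a + b, (w : g)⁆
            rw [add_lie, hb0, add_zero] }
      have hJ : ∀ w : M, w ∈ I ↔ (w : g) ∈ J := fun w =>
        ⟨fun hw => ⟨w, hw, rfl⟩, fun ⟨w', hw', h'⟩ => (Subtype.ext h' : w' = w) ▸ hw'⟩
      have hJM : J ≤ M := by
        rintro _ ⟨w, -, rfl⟩
        exact w.2
      rcases hM.le_iff.1 hJM with hJ0 | hJ1
      · left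
        rw [eq_bot_iff]
        intro w hw
        rw [hJ, hJ0, LieSubmodule.mem_bot] at hw
        exact (LieSubmodule.mem_bot w).2 (Subtype.ext hw)
      · right
        rw [eq_top_iff]
        intro w _
        rw [hJ, hJ1]
        exact w.2
    · have := hab.trivial ⟨x, hx⟩ ⟨y, hy⟩
      exact congrArg Subtype.val this
  · refine lie_eq_zero_of_forall_form (Q := Q) fun z => ?_
    have hy' : y ∈ perp Q M := inf_eq_left.1 h hy
    rw [form_comm]
    exact mem_perp.1 hy' _ (lie_mem_left ℝ g M x z hx)

theorem lie_eq_zero_of_mem_perp_radicalChain (hg : HasNoSimpleIdeals g) {x y : g}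
    (hx : x ∈ perp Q (radicalChain g 1)) (hy : y ∈ perp Q (radicalChain g 1)) : ⁅x, y⁆ = 0 := by
  set S : LieIdeal ℝ g := sSup {M | IsAtom M} with hS
  -- Dually, `S^⊥ ⊆ R₁`: complements of maximal ideals are minimal ideals, so `S^⊥` lies in every
  -- maximal ideal.
  have hle : perp Q (radicalChain g 1) ≤ S := by
    rw [perp_le_iff]
    intro z hz
    refine mem_radicalChain_succ.2 ⟨LieSubmodule.mem_top z, fun M hM => ?_⟩
    have hM' : perp Q M ≤ S := le_sSup (isAtom_perp (covBy_top_iff.1 hM))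
    exact perp_le_iff.1 hM' hz
  -- Distinct minimal ideals commute because they meet in zero.
  have hatom : ∀ N : LieIdeal ℝ g, IsAtom N → S ≤ annihilatedSubmodule g N := by
    refine fun N hN => sSup_le fun M hM v hv n hn => ?_
    rcases eq_or_ne M N with rfl | hMN
    · exact lie_eq_zero_of_isAtom hg Q hN hn hv
    · rw [← LieSubmodule.mem_bot (R := ℝ) (L := g), ← (hM.disjoint_of_ne hN hMN).eq_bot]
      exact ⟨lie_mem_right ℝ g M _ _ hv, lie_mem_left ℝ g N _ _ hn⟩
  have hann : S ≤ annihilatedSubmodule g S := by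
    refine sSup_le fun N hN v hv n hn => ?_
    rw [← lie_skew, hatom N hN hn v hv, neg_zero]
  exact hann (hle hy) x (hle hx)

theorem canonicalIdeal_le_perp : canonicalIdeal Q ≤ perp Q (canonicalIdeal Q) := by
  refine iSup_le fun k y hy => mem_perp_canonicalIdeal.2 fun j x hx hx' => ?_
  rcases le_total j k with h | h
  · rw [form_comm]
    exact mem_perp.1 hx' y (radicalChain_antitone (Nat.succ_le_succ h) hy.1)
  · exact mem_perp.1 hy.2 x (radicalChain_antitone (Nat.succ_le_succ h) hx)

/-- The decomposition comes from `(R ∩ R^⊥)^⊥ = R^⊥ + R`. That `r` stays in `i^⊥` is checked against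
each `R_{j+1} ∩ R_{j+1}^⊥`: for `j ≤ k` it is orthogonal to `R_{k+1} ∋ r`, and for `j ≥ k` it is
orthogonal to `s`, hence to `r = y - s`. -/
theorem exists_add_of_mem_perp_canonicalIdeal (k : ℕ) {y : g}
    (hy : y ∈ perp Q (canonicalIdeal Q)) : ∃ r ∈ radicalChain g (k + 1),
      r ∈ perp Q (canonicalIdeal Q) ∧ ∃ s ∈ perp Q (radicalChain g (k + 1)), r + s = y := by
  have hle : perp Q (canonicalIdeal Q) ≤
      radicalChain g (k + 1) ⊔ perp Q (radicalChain g (k + 1)) := by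
    refine (perp_antitone (le_iSup _ k)).trans ?_
    rw [perp_inf, perp_perp, sup_comm]
  obtain ⟨r, hr, s, hs, rfl⟩ := (LieSubmodule.mem_sup _ _ _).1 (hle hy)
  refine ⟨r, hr, mem_perp_canonicalIdeal.2 fun j x hx hx' => ?_, s, hs, rfl⟩
  rcases le_total j k with h | h
  · rw [form_comm]
    exact mem_perp.1 hx' r (radicalChain_antitone (Nat.succ_le_succ h) hr)
  · have h1 := mem_perp_canonicalIdeal.1 hy j x hx hx'
    have h2 := mem_perp.1 hs x (radicalChain_antitone (Nat.succ_le_succ h) hx)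
    rwa [map_add, h2, add_zero] at h1

theorem lie_mem_canonicalIdeal_of_mem_radicalChain {x : g} (hx : x ∈ radicalChain g 1) {y : g}
    (hy : y ∈ perp Q (canonicalIdeal Q)) : ⁅x, y⁆ ∈ canonicalIdeal Q := by
  obtain ⟨n, hn⟩ := exists_radicalChain_eq_bot (g := g)
  -- Descent along the chain, with `d` the number of steps left before `R_n = 0`. For `y = r + s` in
  -- `R_k`, the term `r` drops to `R_{k+1}`, while `[x, s]` lies in `R_{k+1} ∩ R_{k+1}^⊥`.
  have key : ∀ d k : ℕ, k + d = n → ∀ y ∈ radicalChain g k, y ∈ perp Q (canonicalIdeal Q) →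
      ⁅x, y⁆ ∈ canonicalIdeal Q := by
    intro d
    induction d with
    | zero =>
      rintro k rfl y hy -
      rw [add_zero] at hn
      rw [hn, LieSubmodule.mem_bot] at hy
      rw [hy, lie_zero]
      exact LieSubmodule.zero_mem _
    | succ d ih =>
      intro k hk y hyk hy
      obtain ⟨r, hr, hr', s, hs, rfl⟩ := exists_add_of_mem_perp_canonicalIdeal k hy
      have hsk : s ∈ radicalChain g k := by
        have := (radicalChain g k).sub_mem hyk (radicalChain_succ_le k hr)
        rwa [add_sub_cancel_left] at this
      rw [lie_add]
      refine (canonicalIdeal Q).add_mem (ih (k + 1) (by omega) r hr hr') ?_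
      exact LieSubmodule.mem_iSup_of_mem k
        ⟨lie_mem_radicalChain_succ hx hsk, lie_mem_right ℝ g _ x s hs⟩
  exact key n 0 (zero_add n) y (LieSubmodule.mem_top y) hy

/-- If `g` has no simple ideals, then `i(g)^⊥ / i(g)` is abelian. -/
theorem lie_mem_canonicalIdeal (hg : HasNoSimpleIdeals g) {x y : g}
    (hx : x ∈ perp Q (canonicalIdeal Q)) (hy : y ∈ perp Q (canonicalIdeal Q)) :
    ⁅x, y⁆ ∈ canonicalIdeal Q := by
  obtain ⟨r, hr, hr', s, hs, rfl⟩ := exists_add_of_mem_perp_canonicalIdeal 0 hx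
  have hs' : s ∈ perp Q (canonicalIdeal Q) := by
    have := (perp Q (canonicalIdeal Q)).sub_mem hx hr'
    rwa [add_sub_cancel_left] at this
  rw [add_lie]
  refine (canonicalIdeal Q).add_mem (lie_mem_canonicalIdeal_of_mem_radicalChain hr hy) ?_
  obtain ⟨t, ht, ht', z, hz, rfl⟩ := exists_add_of_mem_perp_canonicalIdeal 0 hy
  rw [lie_add, lie_eq_zero_of_mem_perp_radicalChain hg hs hz, add_zero, ← lie_skew]
  exact (canonicalIdeal Q).neg_mem (lie_mem_canonicalIdeal_of_mem_radicalChain ht hs')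

end Metric

/-! ### Lagrangian subspaces -/

section Signature

variable {V : Type*} [AddCommGroup V] [Module ℝ V]

theorem HasSignature.finiteDimensional {B : LinearMap.BilinForm ℝ V} {p q : ℕ}
    (h : HasSignature B p q) : FiniteDimensional ℝ V := by
  obtain ⟨b, -⟩ := h
  exact Module.Finite.of_basis b

theorem HasSignature.finrank_eq {B : LinearMap.BilinForm ℝ V} {p q : ℕ}
    (h : HasSignature B p q) : Module.finrank ℝ V = p + q := by
  obtain ⟨b, -⟩ := h
  rw [Module.finrank_eq_card_basis b, Fintype.card_sum, Fintype.card_fin, Fintype.card_fin]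

/-- A non-degenerate symmetric form on a `2m`-dimensional space with an `m`-dimensional isotropic
subspace has signature `(m, m)`. -/
theorem hasSignature_of_isIsotropic [FiniteDimensional ℝ V] {B : LinearMap.BilinForm ℝ V}
    (hs : B.IsSymm) (hn : B.Nondegenerate) {W : Submodule ℝ V} (hW : IsIsotropic B W) {m : ℕ}
    (hWm : Module.finrank ℝ W = m) (hV : Module.finrank ℝ V = 2 * m) : HasSignature B m m := by
  let e : Module.Basis (Fin m) ℝ W := Module.finBasisOfFinrankEq ℝ W hWm
  have hφ : ∀ j, ∃ φ : V →ₗ[ℝ] ℝ, φ.comp W.subtype = e.coord j := fun j =>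
    LinearMap.exists_extend _
  choose φ hφ using hφ
  have hφe : ∀ j k, φ j (e k) = if j = k then 1 else 0 := fun j k => by
    have := LinearMap.congr_fun (hφ j) (e k)
    rw [Module.Basis.coord_apply, Module.Basis.repr_self, Finsupp.single_apply] at this
    simpa [eq_comm] using this
  let f₀ : Fin m → V := fun j => (B.toDual hn).symm (φ j)
  have hf₀ : ∀ j x, B (f₀ j) x = φ j x := fun j x =>
    LinearMap.BilinForm.apply_toDual_symm_apply _ _
  let f : Fin m → V := fun j => f₀ j - (1 / 2 : ℝ) • ∑ k, B (f₀ j) (f₀ k) • (e k : V)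
  have hee : ∀ j k, B (e j) (e k) = 0 := fun j k => hW _ (e j).2 _ (e k).2
  have hf₀e : ∀ j k, B (f₀ j) (e k) = if j = k then 1 else 0 := fun j k => by rw [hf₀, hφe]
  have hef₀ : ∀ j k, B (e j) (f₀ k) = if j = k then 1 else 0 := fun j k => by
    rw [hs.eq, hf₀e]; simp [eq_comm]
  have hfe : ∀ j k, B (f j) (e k) = if j = k then 1 else 0 := fun j k => by
    simp [f, hf₀e, hee]
  have hef : ∀ j k, B (e j) (f k) = if j = k then 1 else 0 := fun j k => by
    rw [hs.eq, hfe]; simp [eq_comm]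
  have hff : ∀ j k, B (f j) (f k) = 0 := fun j k => by
    have h1 : B (f j) (f₀ k) = (1 / 2 : ℝ) * B (f₀ j) (f₀ k) := by
      simp [f, hef₀]; ring
    have h2 : B (f j) (f k) = B (f j) (f₀ k) - (1 / 2 : ℝ) * B (f₀ k) (f₀ j) := by
      simp [f, hee, hf₀e]; ring
    rw [h2, h1, hs.eq (f₀ k)]; ring
  -- In each hyperbolic plane `e ∓ f / 2` has square `∓ 2 · (1 / 2) = ∓ 1`.
  let b : Fin m ⊕ Fin m → V := Sum.elim (fun i => (e i : V) - (1 / 2 : ℝ) • f i)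
    (fun i => (e i : V) + (1 / 2 : ℝ) • f i)
  have hbb : ∀ i j, i ≠ j → B (b i) (b j) = 0 := by
    rintro (i | i) (j | j) hij
    · have : i ≠ j := fun h => hij (by rw [h])
      simp [b, hee, hff, hef, hfe, this]
    · by_cases h : i = j <;> simp [b, hee, hff, hef, hfe, h]
    · by_cases h : i = j <;> simp [b, hee, hff, hef, hfe, h]
    · have : i ≠ j := fun h => hij (by rw [h])
      simp [b, hee, hff, hef, hfe, this]
  have hbl : ∀ i, B (b (Sum.inl i)) (b (Sum.inl i)) = -1 := fun i => by
    simp [b, hee, hff, hef, hfe]; norm_num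
  have hbr : ∀ i, B (b (Sum.inr i)) (b (Sum.inr i)) = 1 := fun i => by
    simp [b, hee, hff, hef, hfe]; norm_num
  have hli : LinearIndependent ℝ b := by
    refine LinearMap.linearIndependent_of_isOrthoᵢ (B := B) ?_ ?_
    · exact fun i j hij => hbb i j hij
    · rintro (i | i)
      · rw [hbl]; norm_num
      · rw [hbr]; norm_num
  refine ⟨basisOfLinearIndependentOfCardEqFinrank' b hli ?_, ?_⟩
  · rw [Fintype.card_sum, Fintype.card_fin, hV, two_mul]
  · rw [coe_basisOfLinearIndependentOfCardEqFinrank']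
    exact ⟨hbb, hbl, hbr⟩

end Signature

/-! ### The Lagrangian subalgebra `Ann(l') ⊕ a' ⊕ l'` -/

section Manin

theorem finrank_submodule_prod {V W : Type*} [AddCommGroup V] [Module ℝ V] [AddCommGroup W]
    [Module ℝ W] [FiniteDimensional ℝ V] [FiniteDimensional ℝ W]
    (p : Submodule ℝ V) (q : Submodule ℝ W) :
    Module.finrank ℝ (p.prod q) = Module.finrank ℝ p + Module.finrank ℝ q := by
  rw [← Module.finrank_prod]
  exact LinearEquiv.finrank_eq
    { toFun := fun x => (⟨x.1.1, x.2.1⟩, ⟨x.1.2, x.2.2⟩)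
      invFun := fun y => ⟨(y.1, y.2), y.1.2, y.2.2⟩
      map_add' := fun _ _ => rfl
      map_smul' := fun _ _ => rfl
      left_inv := fun _ => rfl
      right_inv := fun _ => rfl }

variable {l : Type u} {a : Type v} [LieRing l] [LieAlgebra ℝ l] [FiniteDimensional ℝ l]
  [AddCommGroup a] [Module ℝ a] [LieRingModule l a] [LieModule ℝ l a]
  {Q : InvariantInnerProduct l a} (c : QuadraticCocycle Q)

namespace QuadraticCocycle

variable [FiniteDimensional ℝ a]

instance : FiniteDimensional ℝ c.Model :=
  inferInstanceAs (FiniteDimensional ℝ (Module.Dual ℝ l × a × l))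

theorem finrank_model :
    Module.finrank ℝ c.Model = 2 * Module.finrank ℝ l + Module.finrank ℝ a := by
  have h : Module.finrank ℝ c.Model = Module.finrank ℝ (Module.Dual ℝ l × a × l) := rfl
  rw [h, Module.finrank_prod, Module.finrank_prod, Subspace.dual_finrank_eq]
  ring

theorem finrank_maninSubspace (l' : Submodule ℝ l) (a' : Submodule ℝ a) :
    Module.finrank ℝ (c.maninSubspace l' a') = Module.finrank ℝ l + Module.finrank ℝ a' := by
  have h : Module.finrank ℝ (c.maninSubspace l' a') =
      Module.finrank ℝ (l'.dualAnnihilator.prod (a'.prod l')) := rfl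
  rw [h, finrank_submodule_prod, finrank_submodule_prod,
    ← Subspace.finrank_add_finrank_dualAnnihilator_eq l']
  ring

omit [FiniteDimensional ℝ l] [FiniteDimensional ℝ a]

theorem mem_maninSubspace {l' : Submodule ℝ l} {a' : Submodule ℝ a} {X : c.Model} :
    X ∈ c.maninSubspace l' a' ↔
      (∀ x ∈ l', X.dualPart x = 0) ∧ X.modPart ∈ a' ∧ X.algPart ∈ l' := by
  rw [← Submodule.mem_dualAnnihilator]
  rfl

theorem isIsotropic_maninSubspace {l' : Submodule ℝ l} {a' : Submodule ℝ a}
    (ha : IsIsotropic Q.form a') : IsIsotropic c.modelMetric.form (c.maninSubspace l' a') := by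
  intro X hX Y hY
  rw [mem_maninSubspace] at hX hY
  change c.modelForm X Y = 0
  rw [modelForm_apply, ha _ hX.2.1 _ hY.2.1, hX.1 _ hY.2.2, hY.1 _ hX.2.2]
  norm_num

theorem lie_mem_maninSubspace {l' : LieSubalgebra ℝ l} {a' : Submodule ℝ a}
    (ha : IsIsotropic Q.form a') (hla : ∀ x ∈ l', ∀ y ∈ a', ⁅x, y⁆ ∈ a')
    (hα : ∀ x ∈ l', ∀ y ∈ l', c.α x y ∈ a') (hγ : ∀ x ∈ l', ∀ y ∈ l', ∀ z ∈ l', c.γ x y z = 0)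
    {X Y : c.Model} (hX : X ∈ c.maninSubspace l'.toSubmodule a')
    (hY : Y ∈ c.maninSubspace l'.toSubmodule a') :
    ⁅X, Y⁆ ∈ c.maninSubspace l'.toSubmodule a' := by
  rw [mem_maninSubspace] at hX hY ⊢
  obtain ⟨hX1, hX2, hX3⟩ := hX
  obtain ⟨hY1, hY2, hY3⟩ := hY
  refine ⟨fun x hx => ?_, ?_, l'.lie_mem hX3 hY3⟩
  · rw [Model.dualPart_lie, hγ _ hX3 _ hY3 _ hx, ha _ hY2 _ (hα _ hX3 _ hx),
      ha _ hX2 _ (hα _ hY3 _ hx), ha _ (hla _ hx _ hX2) _ hY2, hY1 _ (l'.lie_mem hX3 hx),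
      hX1 _ (l'.lie_mem hY3 hx)]
    norm_num
  · rw [Model.modPart_lie]
    exact a'.sub_mem (a'.add_mem (hα _ hX3 _ hY3) (hla _ hX3 _ hY2)) (hla _ hY3 _ hX2)

end QuadraticCocycle

theorem hasSignature_modelMetric_and_isManinPair (m : ℕ) (l' : LieSubalgebra ℝ l)
    (a' : Submodule ℝ a) (hQ : HasSignature Q.form m m) (hm : Module.finrank ℝ a' = m)
    (ha : IsIsotropic Q.form a') (hla : ∀ x ∈ l', ∀ y ∈ a', ⁅x, y⁆ ∈ a')
    (hα : ∀ x ∈ l', ∀ y ∈ l', c.α x y ∈ a')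
    (hγ : ∀ x ∈ l', ∀ y ∈ l', ∀ z ∈ l', c.γ x y z = 0) :
    HasSignature c.modelMetric.form (m + Module.finrank ℝ l) (m + Module.finrank ℝ l) ∧
      IsManinPair c.modelMetric (c.maninSubspace l'.toSubmodule a') := by
  have := hQ.finiteDimensional
  have hdim : Module.finrank ℝ (c.maninSubspace l'.toSubmodule a') = m + Module.finrank ℝ l := by
    rw [c.finrank_maninSubspace, hm, add_comm]
  have hsig : HasSignature c.modelMetric.form (m + Module.finrank ℝ l) (m + Module.finrank ℝ l) :=
    hasSignature_of_isIsotropic c.modelMetric.symm c.modelMetric.nondegenerate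
      (c.isIsotropic_maninSubspace ha) hdim (by rw [c.finrank_model, hQ.finrank_eq]; ring)
  exact ⟨hsig, _, hsig, fun _ hX _ hY => c.lie_mem_maninSubspace ha hla hα hγ hX hY, hdim,
    c.isIsotropic_maninSubspace ha⟩

end Manin

/-! ### Recognising a metric Lie algebra as `l* ⊕ a ⊕ l` -/

/-- A surjective homomorphism `π : g → l` whose kernel is the orthogonal complement of an isotropic
ideal `(ker π)^⊥` with `ker π / (ker π)^⊥` abelian, together with an isotropic section `s`. -/
structure IsotropicSplitting {g : Type u} [LieRing g] [LieAlgebra ℝ g] (B : MetricStructure g)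
    (l : Type v) [LieRing l] [LieAlgebra ℝ l] where
  π : g →ₗ⁅ℝ⁆ l
  s : l →ₗ[ℝ] g
  π_s : ∀ x, π (s x) = x
  form_s_s : ∀ x y, B.form (s x) (s y) = 0
  coisotropic : ∀ X, (∀ Y, π Y = 0 → B.form X Y = 0) → π X = 0
  form_lie_ker : ∀ X Y W, π X = 0 → π Y = 0 → π W = 0 → B.form ⁅X, Y⁆ W = 0

/-- The transpose `l* → g* ≅ g` of a linear map `g → l`. -/
def dualEmbedding {g l : Type*} [LieRing g] [LieAlgebra ℝ g] [FiniteDimensional ℝ g]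
    [AddCommGroup l] [Module ℝ l] (B : MetricStructure g) (f : g →ₗ[ℝ] l) :
    Module.Dual ℝ l →ₗ[ℝ] g :=
  (B.form.toDual B.nondegenerate).symm.toLinearMap ∘ₗ f.dualMap

theorem form_dualEmbedding {g l : Type*} [LieRing g] [LieAlgebra ℝ g] [FiniteDimensional ℝ g]
    [AddCommGroup l] [Module ℝ l] {B : MetricStructure g} (f : g →ₗ[ℝ] l) (Z : Module.Dual ℝ l)
    (X : g) : B.form (dualEmbedding B f Z) X = Z (f X) :=
  LinearMap.BilinForm.apply_toDual_symm_apply (hB := B.nondegenerate) _ _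

namespace IsotropicSplitting

variable {g : Type u} [LieRing g] [LieAlgebra ℝ g] {B : MetricStructure g}
  {l : Type v} [LieRing l] [LieAlgebra ℝ l] (S : IsotropicSplitting B l)

/-- The linear form `⟨X, s(·)⟩`. -/
def z : g →ₗ[ℝ] Module.Dual ℝ l := S.s.dualMap ∘ₗ B.form

@[simp] theorem z_apply (X : g) (x : l) : S.z X x = B.form X (S.s x) := rfl

/-- The orthogonal complement of `l* ⊕ l`. -/
def modSpace : Submodule ℝ g := LinearMap.ker (S.π : g →ₗ[ℝ] l) ⊓ LinearMap.ker S.z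

theorem mem_modSpace {X : g} : X ∈ S.modSpace ↔ S.π X = 0 ∧ ∀ x, B.form X (S.s x) = 0 := by
  rw [modSpace, Submodule.mem_inf, LinearMap.mem_ker, LinearMap.mem_ker, LinearMap.ext_iff]
  rfl

@[simp] theorem z_s (x : l) : S.z (S.s x) = 0 := LinearMap.ext fun y => S.form_s_s x y

theorem form_lie_right (X Y W : g) : B.form ⁅X, Y⁆ W = B.form X ⁅Y, W⁆ := by
  rw [← lie_skew, map_neg, LinearMap.neg_apply, form_lie, neg_neg]

@[simp] theorem π_coe (A : S.modSpace) : S.π (A : g) = 0 := (S.mem_modSpace.1 A.2).1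

@[simp] theorem form_coe_s (A : S.modSpace) (x : l) : B.form (A : g) (S.s x) = 0 :=
  (S.mem_modSpace.1 A.2).2 x

@[simp] theorem form_s_coe (A : S.modSpace) (x : l) : B.form (S.s x) (A : g) = 0 := by
  rw [form_comm, form_coe_s]

@[simp] theorem z_coe (A : S.modSpace) : S.z (A : g) = 0 := LinearMap.ext fun x => S.form_coe_s A x

theorem π_lie_coe (X : g) (A : S.modSpace) : S.π ⁅X, (A : g)⁆ = 0 := by
  rw [LieHom.map_lie, π_coe, lie_zero]

/-- The `l*`-component of the bracket of `l`. -/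
def γ : l →ₗ[ℝ] l →ₗ[ℝ] l →ₗ[ℝ] ℝ :=
  LinearMap.mk₂ ℝ (fun x y => S.z ⁅S.s x, S.s y⁆)
    (fun x y z => by simp) (fun t x y => by simp) (fun x y z => by simp) (fun t x y => by simp)

theorem γ_apply (x y w : l) : S.γ x y w = B.form ⁅S.s x, S.s y⁆ (S.s w) := rfl

theorem γ_swap (x y w : l) : S.γ x y w = - S.γ y x w := by
  rw [γ_apply, ← lie_skew, map_neg, LinearMap.neg_apply, γ_apply]

theorem γ_cyclic (x y w : l) : S.γ x y w = S.γ y w x := by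
  rw [γ_apply, form_lie_right, form_comm, γ_apply]

variable [FiniteDimensional ℝ g]

/-- The embedding of `l*` into `g`. -/
def p : Module.Dual ℝ l →ₗ[ℝ] g := dualEmbedding B (S.π : g →ₗ[ℝ] l)

theorem form_p (Z : Module.Dual ℝ l) (X : g) : B.form (S.p Z) X = Z (S.π X) :=
  form_dualEmbedding _ Z X

theorem form_p' (Z : Module.Dual ℝ l) (X : g) : B.form X (S.p Z) = Z (S.π X) := by
  rw [form_comm, form_p]

@[simp] theorem π_p (Z : Module.Dual ℝ l) : S.π (S.p Z) = 0 :=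
  S.coisotropic _ fun Y hY => by rw [form_p, hY, map_zero]

/-- The projection onto the orthogonal complement of `l* ⊕ l`. -/
def q : g →ₗ[ℝ] S.modSpace :=
  LinearMap.codRestrict _ (LinearMap.id - S.s ∘ₗ (S.π : g →ₗ[ℝ] l) - S.p ∘ₗ S.z) fun X => by
    refine S.mem_modSpace.2 ⟨?_, fun x => ?_⟩
    · change S.π (X - S.s (S.π X) - S.p (S.z X)) = 0
      rw [map_sub, map_sub, S.π_s, S.π_p, sub_self, sub_zero]
    · change B.form (X - S.s (S.π X) - S.p (S.z X)) (S.s x) = 0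
      rw [map_sub, map_sub, LinearMap.sub_apply, LinearMap.sub_apply, S.form_s_s, S.form_p, S.π_s,
        z_apply, sub_zero, sub_self]

theorem coe_q (X : g) : (S.q X : g) = X - S.s (S.π X) - S.p (S.z X) := rfl

theorem decomp (X : g) : X = S.p (S.z X) + (S.q X : g) + S.s (S.π X) := by
  rw [coe_q]; abel

theorem form_eq (X Y : g) : B.form X Y =
    B.form (S.q X : g) (S.q Y) + S.z X (S.π Y) + S.z Y (S.π X) := by
  conv_lhs => rw [S.decomp X, S.decomp Y]
  simp only [map_add, LinearMap.add_apply, S.form_p, S.form_p', S.form_s_s, S.form_coe_s,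
    S.form_s_coe, S.π_s, S.π_p, S.π_coe, map_zero]
  ring

@[simp] theorem q_coe (A : S.modSpace) : S.q (A : g) = A :=
  Subtype.ext (by rw [coe_q, π_coe, z_coe, map_zero, map_zero, sub_zero, sub_zero])

@[simp] theorem q_s (x : l) : S.q (S.s x) = 0 :=
  Subtype.ext (by rw [coe_q, S.π_s, z_s, map_zero, sub_self, sub_zero]; rfl)

@[simp] theorem z_p (Z : Module.Dual ℝ l) : S.z (S.p Z) = Z :=
  LinearMap.ext fun x => by rw [z_apply, form_p, S.π_s]

@[simp] theorem q_p (Z : Module.Dual ℝ l) : S.q (S.p Z) = 0 :=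
  Subtype.ext (by rw [coe_q, S.π_p, z_p, map_zero, sub_zero, sub_self]; rfl)

/-- The form is non-degenerate on `modSpace`, which is orthogonal to the other two summands of `g`.
Identities in `a` are therefore proved by pairing with elements of `a`. -/
theorem eq_of_forall_form {A A' : S.modSpace}
    (h : ∀ C : S.modSpace, B.form (A : g) C = B.form (A' : g) C) : A = A' := by
  refine sub_eq_zero.1 (Subtype.ext (B.nondegenerate.1 _ fun Y => ?_))
  rw [S.form_eq, q_coe, π_coe, z_coe, LinearMap.zero_apply, map_zero, add_zero, add_zero]
  have := h (S.q Y)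
  rw [Submodule.coe_sub, map_sub, LinearMap.sub_apply, this, sub_self]

theorem form_coe_q (X Y : g) (hY : S.π Y = 0) :
    B.form (S.q X : g) Y = B.form X Y - B.form Y (S.s (S.π X)) := by
  rw [S.form_eq X Y, S.form_eq _ Y, q_coe, z_coe, π_coe, hY]
  simp

@[simp] theorem form_coe_q_coe (X : g) (A : S.modSpace) :
    B.form (S.q X : g) (A : g) = B.form X (A : g) := by
  rw [S.form_coe_q X _ (S.π_coe A), form_coe_s, sub_zero]

/-! #### The orthogonal module -/

instance : Bracket l S.modSpace where
  bracket x A := S.q ⁅S.s x, (A : g)⁆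

theorem lie_def (x : l) (A : S.modSpace) : ⁅x, A⁆ = S.q ⁅S.s x, (A : g)⁆ := rfl

theorem form_coe_lie (x : l) (A : S.modSpace) (Y : g) (hY : S.π Y = 0) :
    B.form ((⁅x, A⁆ : S.modSpace) : g) Y = B.form ⁅S.s x, (A : g)⁆ Y := by
  rw [lie_def, S.form_coe_q _ _ hY, π_lie_coe, map_zero, map_zero, sub_zero]

theorem form_lie_coe_lie (x y : l) (A C : S.modSpace) :
    B.form ((⁅x, ⁅y, A⁆⁆ : S.modSpace) : g) C = B.form ⁅S.s x, ⁅S.s y, (A : g)⁆⁆ C := by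
  rw [form_coe_lie _ _ _ _ (π_coe _ _), form_lie, form_coe_lie _ _ _ _ (π_lie_coe _ _ _),
    form_lie B (S.s x)]

instance : LieRingModule l S.modSpace where
  add_lie x y A := by simp only [lie_def, map_add, add_lie]
  lie_add x A A' := by simp only [lie_def, Submodule.coe_add, map_add, lie_add]
  leibniz_lie x y A := by
    refine S.eq_of_forall_form fun C => ?_
    -- The failure of `s` to be a homomorphism lies in `ker π`, which acts trivially on `a` because
    -- `ker π / (ker π)^⊥` is abelian.
    have h : B.form ⁅S.s ⁅x, y⁆ - ⁅S.s x, S.s y⁆, (A : g)⁆ (C : g) = 0 :=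
      S.form_lie_ker _ _ _ (by rw [map_sub, S.π_s, LieHom.map_lie, S.π_s, S.π_s, sub_self])
        (S.π_coe A) (S.π_coe C)
    rw [sub_lie, lie_lie (S.s x), map_sub, map_sub, LinearMap.sub_apply, LinearMap.sub_apply] at h
    rw [Submodule.coe_add, map_add, LinearMap.add_apply, form_lie_coe_lie, form_lie_coe_lie,
      form_coe_lie _ _ _ _ (π_coe _ _)]
    linarith

instance : LieModule ℝ l S.modSpace where
  smul_lie t x A := by simp only [lie_def, map_smul, smul_lie]
  lie_smul t x A := by simp only [lie_def, Submodule.coe_smul, map_smul, lie_smul]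

/-- The inner product on `a`. -/
def inner : InvariantInnerProduct l S.modSpace where
  form := B.form.restrict S.modSpace
  symm := ⟨fun A A' => form_comm B (A : g) A'⟩
  nondegenerate := by
    refine ⟨fun A h => S.eq_of_forall_form fun C => ?_, fun A h => S.eq_of_forall_form fun C => ?_⟩
    · exact (h C).trans (by rw [Submodule.coe_zero, map_zero, LinearMap.zero_apply])
    · rw [form_comm]
      exact (h C).trans (by rw [Submodule.coe_zero, map_zero, LinearMap.zero_apply])
  invariant x A A' := by
    change B.form ((⁅x, A⁆ : S.modSpace) : g) A' = - B.form (A : g) (⁅x, A'⁆ : S.modSpace)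
    rw [form_coe_lie _ _ _ _ (π_coe _ _), form_comm B (A : g), form_coe_lie _ _ _ _ (π_coe _ _),
      form_lie, form_comm B (A : g)]

theorem inner_form (A A' : S.modSpace) : S.inner.form A A' = B.form (A : g) A' := rfl

/-! #### The quadratic cocycle -/

/-- The `a`-component of the bracket of `l`. -/
def α : twoCochain ℝ l S.modSpace :=
  ⟨LinearMap.mk₂ ℝ (fun x y => S.q ⁅S.s x, S.s y⁆)
    (fun x y z => by simp) (fun t x y => by simp) (fun x y z => by simp) (fun t x y => by simp),
    fun x => by simp⟩

theorem α_apply (x y : l) : S.α x y = S.q ⁅S.s x, S.s y⁆ := rfl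

theorem form_lie_α (x y w : l) (C : S.modSpace) :
    B.form ((⁅x, S.α y w⁆ : S.modSpace) : g) C =
      B.form ⁅S.s x, ⁅S.s y, S.s w⁆⁆ C - B.form ⁅S.s x, S.s ⁅y, w⁆⁆ C := by
  rw [form_coe_lie _ _ _ _ (π_coe _ _), form_lie, α_apply, form_coe_q _ _ _ (π_lie_coe _ _ _),
    form_lie B (S.s x) ⁅S.s y, S.s w⁆, form_lie B (S.s x) (S.s ⁅y, w⁆), LieHom.map_lie, S.π_s,
    S.π_s, form_comm B _ (S.s ⁅y, w⁆)]
  ring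

/-- By invariance the left side is `⟨[s x₁, s x₂], [s x₃, s x₄]⟩`, which splits along `l* ⊕ a ⊕ l`.
Summed over the Jacobi identity it yields `dγ = ½⟨α ∧ α⟩`. -/
theorem form_lie_s_lie_s (x₁ x₂ x₃ x₄ : l) :
    B.form ⁅⁅S.s x₁, S.s x₂⁆, S.s x₃⁆ (S.s x₄) =
      S.inner.form (S.α x₁ x₂) (S.α x₃ x₄) + S.γ x₁ x₂ ⁅x₃, x₄⁆ + S.γ x₃ x₄ ⁅x₁, x₂⁆ := by
  rw [form_lie_right, S.form_eq, inner_form, LieHom.map_lie, LieHom.map_lie, S.π_s, S.π_s, S.π_s,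
    S.π_s]
  rfl

/-- The quadratic cocycle of a splitting. -/
def cocycle : QuadraticCocycle S.inner where
  α := S.α
  γ := S.γ
  alternating := by
    refine ⟨fun x y => ?_, fun x y => ?_⟩
    · rw [γ_apply, lie_self, map_zero, LinearMap.zero_apply]
    · rw [γ_apply, form_lie_right, lie_self, map_zero]
  d_α := by
    refine LinearMap.ext fun x => LinearMap.ext fun y => LinearMap.ext fun w =>
      S.eq_of_forall_form fun C => ?_
    have hJ := congrArg (fun X => B.form X (C : g)) (lie_jacobi (S.s x) (S.s y) (S.s w))
    have hskew : ∀ X Y : g, B.form ⁅X, Y⁆ (C : g) = - B.form ⁅Y, X⁆ (C : g) := fun X Y => by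
      rw [← lie_skew, map_neg, LinearMap.neg_apply]
    have h₁ : B.form ⁅S.s y, ⁅S.s w, S.s x⁆⁆ (C : g) = - B.form ⁅S.s y, ⁅S.s x, S.s w⁆⁆ (C : g) := by
      rw [← lie_skew (S.s x), lie_neg, map_neg, LinearMap.neg_apply, neg_neg]
    simp only [map_add, LinearMap.add_apply, map_zero, LinearMap.zero_apply] at hJ
    simp only [d₂₃_apply, Submodule.coe_add, Submodule.coe_sub, map_add, map_sub,
      LinearMap.add_apply, LinearMap.sub_apply, form_lie_α, LinearMap.zero_apply,
      Submodule.coe_zero, map_zero]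
    simp only [α_apply, form_coe_q_coe]
    linarith [hskew (S.s x) (S.s ⁅y, w⁆), hskew (S.s y) (S.s ⁅x, w⁆), hskew (S.s w) (S.s ⁅x, y⁆)]
  d_γ x₁ x₂ x₃ x₄ := by
    have hJ := congrArg (fun X => B.form X (S.s x₄)) (lie_jacobi (S.s x₁) (S.s x₂) (S.s x₃))
    have hskew : ∀ X Y : g, B.form ⁅X, Y⁆ (S.s x₄) = - B.form ⁅Y, X⁆ (S.s x₄) := fun X Y => by
      rw [← lie_skew, map_neg, LinearMap.neg_apply]
    simp only [map_add, LinearMap.add_apply, map_zero, LinearMap.zero_apply] at hJ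
    rw [hskew (S.s x₁), hskew (S.s x₂), hskew (S.s x₃), form_lie_s_lie_s, form_lie_s_lie_s,
      form_lie_s_lie_s, ← twoCochain_skew S.α x₁ x₃, ← lie_skew x₃ x₁, S.γ_swap x₃ x₁, map_neg,
      map_neg, LinearMap.neg_apply] at hJ
    simp only [coboundary, innerWedge]
    rw [S.γ_cyclic _ x₃ x₄, S.γ_cyclic _ x₂ x₄, S.γ_cyclic _ x₂ x₃, S.γ_cyclic _ x₁ x₄,
      S.γ_cyclic _ x₁ x₃, S.γ_cyclic _ x₁ x₂, form_comm S.inner (S.α x₁ x₄),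
      form_comm S.inner (S.α x₂ x₄), form_comm S.inner (S.α x₃ x₄)]
    linarith

/-! #### The isomorphism -/

theorem form_lie_p (Z : Module.Dual ℝ l) (X Y : g) :
    B.form ⁅S.p Z, X⁆ Y = Z ⁅S.π X, S.π Y⁆ := by
  rw [form_lie_right, form_p, LieHom.map_lie]

theorem form_lie_p' (Z : Module.Dual ℝ l) (X Y : g) :
    B.form ⁅X, S.p Z⁆ Y = - Z ⁅S.π X, S.π Y⁆ := by
  rw [form_lie, form_p, LieHom.map_lie]

theorem form_lie_decomp (X Y W : g) : B.form ⁅X, Y⁆ W = B.form ⁅S.p (S.z X), Y⁆ W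
    + B.form ⁅(S.q X : g) + S.s (S.π X), S.p (S.z Y)⁆ W
    + B.form ⁅(S.q X : g) + S.s (S.π X), (S.q Y : g) + S.s (S.π Y)⁆ W := by
  conv_lhs => rw [S.decomp X, add_assoc, add_lie, map_add, LinearMap.add_apply]
  rw [add_assoc]
  congr 1
  conv_lhs => rw [S.decomp Y, add_assoc, lie_add, map_add, LinearMap.add_apply]

open QuadraticCocycle in
/-- The isomorphism of `g` and `l* ⊕ a ⊕ l`. -/
def equiv : g ≃ₗ⁅ℝ⁆ S.cocycle.Model where
  toFun X := Model.mk S.cocycle (S.z X) (S.q X) (S.π X)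
  invFun X := S.p (Model.dualPart X) + ((Model.modPart X : S.modSpace) : g) + S.s (Model.algPart X)
  left_inv X := (S.decomp X).symm
  right_inv X := by
    refine Model.ext (fun x => ?_) ?_ ?_
    · simp
    · simp
    · simp [S.π_s]
  map_add' X Y := Model.ext (fun x => by simp) (by simp) (by simp)
  map_smul' t X := Model.ext (fun x => by simp) (by simp) (by simp)
  map_lie' {X Y} := by
    refine Model.ext (fun x => ?_) (S.eq_of_forall_form fun C => ?_) (LieHom.map_lie _ _ _)
    · rw [Model.dualPart_lie]
      simp only [Model.dualPart_mk, Model.modPart_mk, Model.algPart_mk, z_apply]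
      have h₃ : B.form ⁅(S.q X : g), (S.q Y : g)⁆ (S.s x) =
          B.form ((⁅x, S.q X⁆ : S.modSpace) : g) (S.q Y) := by
        rw [form_coe_lie _ _ _ _ (S.π_coe _), form_lie_right, ← lie_skew, map_neg, form_lie]
      have h₄ : B.form ⁅(S.q X : g), S.s (S.π Y)⁆ (S.s x) =
          B.form (S.q X : g) (S.α (S.π Y) x : S.modSpace) := by
        rw [form_lie_right, form_comm, form_comm B (S.q X : g), α_apply, form_coe_q_coe]
      have h₅ : B.form ⁅S.s (S.π X), (S.q Y : g)⁆ (S.s x) =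
          - B.form (S.q Y : g) (S.α (S.π X) x : S.modSpace) := by
        rw [form_lie, form_comm, form_comm B (S.q Y : g), α_apply, form_coe_q_coe]
      rw [S.form_lie_decomp X Y, form_lie_p, form_lie_p', add_lie, lie_add, lie_add]
      simp only [map_add, LinearMap.add_apply, S.π_s, π_coe, zero_add]
      rw [h₃, h₄, h₅]
      simp only [z_apply]
      change _ = B.form ⁅S.s (S.π X), S.s (S.π Y)⁆ (S.s x)
        - B.form (S.q Y : g) (S.α (S.π X) x : S.modSpace)
        + B.form (S.q X : g) (S.α (S.π Y) x : S.modSpace)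
        + B.form ((⁅x, S.q X⁆ : S.modSpace) : g) (S.q Y) - _ + _
      ring
    · rw [Model.modPart_lie]
      simp only [Model.modPart_mk, Model.algPart_mk]
      rw [form_coe_q_coe, S.form_lie_decomp X Y, form_lie_p, form_lie_p', add_lie, lie_add, lie_add]
      simp only [map_add, map_sub, LinearMap.add_apply, LinearMap.sub_apply, π_coe, lie_zero,
        map_zero, Submodule.coe_add, Submodule.coe_sub, form_coe_lie _ _ _ _ (S.π_coe C)]
      -- The bracket of two elements of `a` has no `a`-component.
      rw [S.form_lie_ker _ _ _ (S.π_coe _) (S.π_coe _) (S.π_coe _), ← lie_skew (S.q X : g), map_neg,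
        LinearMap.neg_apply]
      change _ = B.form (S.q ⁅S.s (S.π X), S.s (S.π Y)⁆ : g) (C : g) + _ - _
      rw [form_coe_q_coe]
      ring

theorem form_equiv (X Y : g) : S.cocycle.modelMetric.form (S.equiv X) (S.equiv Y) = B.form X Y := by
  rw [S.form_eq]
  rfl

end IsotropicSplitting

/-! ### Invariance of the canonical isotropic ideal -/

section Transport

variable {g₁ g₂ : Type*} [LieRing g₁] [LieAlgebra ℝ g₁] [LieRing g₂] [LieAlgebra ℝ g₂]

/-- The bijection of ideals induced by an isomorphism. -/
def idealIso (F : g₁ ≃ₗ⁅ℝ⁆ g₂) : LieIdeal ℝ g₂ ≃o LieIdeal ℝ g₁ where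
  toFun I := I.comap (F : g₁ →ₗ⁅ℝ⁆ g₂)
  invFun I := I.comap (F.symm : g₂ →ₗ⁅ℝ⁆ g₁)
  left_inv I := by
    ext x
    change F (F.symm x) ∈ I ↔ _
    rw [F.apply_symm_apply]
  right_inv I := by
    ext x
    change F.symm (F x) ∈ I ↔ _
    rw [F.symm_apply_apply]
  map_rel_iff' {I J} := by
    refine ⟨fun h x hx => ?_, fun h x hx => h hx⟩
    have hx' : F.symm x ∈ I.comap (F : g₁ →ₗ⁅ℝ⁆ g₂) := by
      change F (F.symm x) ∈ I
      rwa [F.apply_symm_apply]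
    have h' : F (F.symm x) ∈ J := h hx'
    rwa [F.apply_symm_apply] at h'

theorem mem_idealIso {F : g₁ ≃ₗ⁅ℝ⁆ g₂} {I : LieIdeal ℝ g₂} {x : g₁} :
    x ∈ idealIso F I ↔ F x ∈ I := Iff.rfl

variable [FiniteDimensional ℝ g₁] [FiniteDimensional ℝ g₂]

/-- The description of `R_{k+1}` by ideals covered by `R_k` uses only the lattice of ideals and
membership. -/
theorem idealIso_radicalChain (F : g₁ ≃ₗ⁅ℝ⁆ g₂) (k : ℕ) :
    idealIso F (radicalChain g₂ k) = radicalChain g₁ k := by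
  induction k with
  | zero => exact (idealIso F).map_top
  | succ k ih =>
    ext x
    rw [mem_idealIso, mem_radicalChain_succ, mem_radicalChain_succ, ← ih, mem_idealIso]
    refine and_congr_right fun _ => ⟨fun h M hM => ?_, fun h M hM => ?_⟩
    · obtain ⟨N, rfl⟩ := (idealIso F).surjective M
      exact h N ((apply_covBy_apply_iff (idealIso F)).1 hM)
    · exact h (idealIso F M) ((apply_covBy_apply_iff (idealIso F)).2 hM)

theorem apply_mem_radicalChain (F : g₁ ≃ₗ⁅ℝ⁆ g₂) {k : ℕ} {x : g₁} :
    F x ∈ radicalChain g₂ k ↔ x ∈ radicalChain g₁ k := by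
  rw [← mem_idealIso, idealIso_radicalChain]

theorem map_canonicalIsotropicIdeal {Q₁ : MetricStructure g₁} {Q₂ : MetricStructure g₂}
    (F : g₁ ≃ₗ⁅ℝ⁆ g₂) (hF : ∀ x y, Q₂.form (F x) (F y) = Q₁.form x y) :
    (canonicalIsotropicIdeal Q₁).map (F : g₁ →ₗ[ℝ] g₂) = canonicalIsotropicIdeal Q₂ := by
  rw [canonicalIsotropicIdeal, canonicalIsotropicIdeal, Submodule.map_iSup]
  refine iSup_congr fun k => Submodule.ext fun y => ?_
  obtain ⟨x, rfl⟩ := F.surjective y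
  have h : ∀ x, F x ∈ (radicalChain g₂ (k + 1)).toSubmodule ⊓
      Q₂.form.orthogonal (radicalChain g₂ (k + 1)).toSubmodule ↔
      x ∈ (radicalChain g₁ (k + 1)).toSubmodule ⊓
      Q₁.form.orthogonal (radicalChain g₁ (k + 1)).toSubmodule := by
    intro x
    refine and_congr (apply_mem_radicalChain F) ⟨fun h n hn => ?_, fun h n hn => ?_⟩
    · rw [← hF]
      exact h _ ((apply_mem_radicalChain F).2 hn)
    · obtain ⟨n, rfl⟩ := F.surjective n
      exact (hF n x).trans (h _ ((apply_mem_radicalChain F).1 hn))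
  refine Iff.trans ⟨?_, fun hx => ⟨x, hx, rfl⟩⟩ (h x).symm
  rintro ⟨x', hx', hxx⟩
  rwa [← F.injective hxx]

end Transport

/-! ### Splittings adapted to a Lagrangian subalgebra -/

section Adapted

variable {g : Type u} [LieRing g] [LieAlgebra ℝ g] {B : MetricStructure g}

/-- The projection of a Lie algebra to the quotient by an ideal. -/
def quotientMap (I : LieIdeal ℝ g) : g →ₗ⁅ℝ⁆ g ⧸ I :=
  { (LieSubmodule.Quotient.mk' I : g →ₗ[ℝ] g ⧸ I) with
    map_lie' := fun {x y} => LieSubmodule.Quotient.mk_bracket I x y }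

theorem quotientMap_eq_zero {I : LieIdeal ℝ g} {x : g} : quotientMap I x = 0 ↔ x ∈ I :=
  LieSubmodule.Quotient.mk_eq_zero I

theorem IsotropicSplitting.z_π_eq_zero {l : Type v} [LieRing l] [LieAlgebra ℝ l]
    (S : IsotropicSplitting B l) {h : Submodule ℝ g} (hiso : IsIsotropic B.form h)
    (hs : ∀ X ∈ h, S.s (S.π X) ∈ h) {X Y : g} (hX : X ∈ h) (hY : Y ∈ h) : S.z X (S.π Y) = 0 :=
  hiso _ hX _ (hs Y hY)

variable [FiniteDimensional ℝ g]

/-- Take any section `τ`, and a section `σ` of `h → π(h)`. On `π(h)` they differ by a map into `ker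
π`; extending this difference to `W` corrects `τ`. -/
theorem exists_section_map_le {V W : Type*} [AddCommGroup V] [Module ℝ V] [AddCommGroup W]
    [Module ℝ W] {π : V →ₗ[ℝ] W} (hπ : Function.Surjective π) (h : Submodule ℝ V) :
    ∃ s : W →ₗ[ℝ] V, (∀ x, π (s x) = x) ∧ ∀ x ∈ h, s (π x) ∈ h := by
  obtain ⟨τ, hτ⟩ := π.exists_rightInverse_of_surjective (LinearMap.range_eq_top.2 hπ)
  obtain ⟨σ, hσ⟩ := (π.submoduleMap h).exists_rightInverse_of_surjective
    (LinearMap.range_eq_top.2 (π.submoduleMap_surjective h))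
  have hτ' : ∀ x, π (τ x) = x := LinearMap.congr_fun hτ
  have hσ' : ∀ x, π (σ x) = x := fun x => congrArg Subtype.val (LinearMap.congr_fun hσ x)
  obtain ⟨δ, hδ⟩ := LinearMap.exists_extend
    (LinearMap.codRestrict (LinearMap.ker π) (h.subtype ∘ₗ σ - τ ∘ₗ (h.map π).subtype) fun x => by
      change π (σ x - τ x) = 0
      rw [map_sub, hσ', hτ', sub_self])
  refine ⟨τ + (LinearMap.ker π).subtype ∘ₗ δ, fun x => ?_, fun x hx => ?_⟩
  · change π (τ x + δ x) = x
    rw [map_add, hτ', (δ x).2, add_zero]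
  · have h₁ := congrArg Subtype.val (LinearMap.congr_fun hδ ⟨π x, Submodule.mem_map_of_mem hx⟩)
    change (δ (π x) : V) = σ _ - τ (π x) at h₁
    change τ (π x) + (δ (π x) : V) ∈ h
    rw [h₁, add_sub_cancel]
    exact Subtype.prop _

/-- A section adapted to `h` becomes isotropic after subtracting half of its Gram form, viewed in
`l* ⊆ ker π`. It stays adapted because over `π(h)` this correction is orthogonal to `h`, hence in
`h` by maximality. -/
theorem exists_isotropicSplitting {l : Type v} [LieRing l] [LieAlgebra ℝ l] (π : g →ₗ⁅ℝ⁆ l)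
    (hπ : Function.Surjective π)
    (hco : ∀ X, (∀ Y, π Y = 0 → B.form X Y = 0) → π X = 0)
    (hab : ∀ X Y W, π X = 0 → π Y = 0 → π W = 0 → B.form ⁅X, Y⁆ W = 0)
    {h : Submodule ℝ g} (hiso : IsIsotropic B.form h)
    (hmax : ∀ X, (∀ Y ∈ h, B.form X Y = 0) → X ∈ h) :
    ∃ S : IsotropicSplitting B l, S.π = π ∧ ∀ X ∈ h, S.s (π X) ∈ h := by
  obtain ⟨s, hs, hsh⟩ := exists_section_map_le (π := (π : g →ₗ[ℝ] l)) hπ h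
  have hs' : ∀ x, π (s x) = x := hs
  set p := dualEmbedding B (π : g →ₗ[ℝ] l)
  have hp : ∀ Z X, B.form (p Z) X = Z (π X) := form_dualEmbedding _
  have hπp : ∀ Z, π (p Z) = 0 := fun Z => hco _ fun Y hY => by rw [hp, hY, map_zero]
  let t : l →ₗ[ℝ] g := s - (1 / 2 : ℝ) • (p ∘ₗ s.dualMap ∘ₗ B.form ∘ₗ s)
  let Z : l → Module.Dual ℝ l := fun x => s.dualMap (B.form (s x))
  have hZ : ∀ x y, Z x y = B.form (s x) (s y) := fun _ _ => rfl
  have ht : ∀ x, t x = s x - (1 / 2 : ℝ) • p (Z x) := fun _ => rfl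
  refine ⟨⟨π, t, fun x => ?_, fun x y => ?_, hco, hab⟩, rfl, fun X hX => ?_⟩
  · rw [ht, map_sub, map_smul, hπp, smul_zero, sub_zero, hs']
  · rw [ht, ht]
    simp only [map_sub, map_smul, LinearMap.sub_apply, LinearMap.smul_apply, hp, hπp, map_zero,
      form_comm B (s x) (p _), hs', hZ, smul_eq_mul]
    rw [form_comm B (s y)]
    ring
  · change t (π X) ∈ h
    rw [ht]
    refine h.sub_mem (hsh X hX) (h.smul_mem _ (hmax _ fun Y hY => ?_))
    rw [hp, hZ]
    exact hiso _ (hsh X hX) _ (hsh Y hY)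

namespace IsotropicSplitting

variable {l : Type v} [LieRing l] [LieAlgebra ℝ l] (S : IsotropicSplitting B l)
  {h : Submodule ℝ g}

theorem p_mem (hmax : ∀ X, (∀ Y ∈ h, B.form X Y = 0) → X ∈ h) {Z : Module.Dual ℝ l}
    (hZ : ∀ X ∈ h, Z (S.π X) = 0) : S.p Z ∈ h :=
  hmax _ fun Y hY => by rw [form_p, hZ Y hY]

theorem q_mem (hiso : IsIsotropic B.form h) (hmax : ∀ X, (∀ Y ∈ h, B.form X Y = 0) → X ∈ h)
    (hs : ∀ X ∈ h, S.s (S.π X) ∈ h) {X : g} (hX : X ∈ h) : (S.q X : g) ∈ h :=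
  h.sub_mem (h.sub_mem hX (hs X hX)) (S.p_mem hmax fun _ hY => S.z_π_eq_zero hiso hs hX hY)

/-- The section preserves `h` by assumption and the other two projections then do so by maximality,
so `h` is the sum of its components. -/
theorem map_equiv (hiso : IsIsotropic B.form h) (hmax : ∀ X, (∀ Y ∈ h, B.form X Y = 0) → X ∈ h)
    (hs : ∀ X ∈ h, S.s (S.π X) ∈ h) :
    h.map (S.equiv : g →ₗ[ℝ] S.cocycle.Model) =
      S.cocycle.maninSubspace (h.map (S.π : g →ₗ[ℝ] l)) (h.comap S.modSpace.subtype) := by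
  refine le_antisymm ?_ fun Y hY => ?_
  · rintro _ ⟨X, hX, rfl⟩
    refine (S.cocycle.mem_maninSubspace).2 ⟨?_, S.q_mem hiso hmax hs hX, X, hX, rfl⟩
    rintro _ ⟨Y, hY, rfl⟩
    exact S.z_π_eq_zero hiso hs hX hY
  · obtain ⟨X, rfl⟩ := S.equiv.surjective Y
    obtain ⟨h₁, h₂, W, hW, hWX⟩ := (S.cocycle.mem_maninSubspace).1 hY
    refine ⟨X, ?_, rfl⟩
    have hWX' : S.π W = S.π X := hWX
    rw [S.decomp X, ← hWX']
    refine h.add_mem (h.add_mem (S.p_mem hmax fun Y hY => ?_) h₂) (hs W hW)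
    exact h₁ _ ⟨Y, hY, rfl⟩

open QuadraticCocycle in
theorem equiv_mem_dualIdeal {X : g} : S.equiv X ∈ S.cocycle.dualIdeal ↔
    ∀ Y, S.π Y = 0 → B.form X Y = 0 := by
  have hiff : S.equiv X ∈ S.cocycle.dualIdeal ↔ S.q X = 0 ∧ S.π X = 0 :=
    ⟨fun h => ⟨h.2.1, h.2.2⟩, fun h => ⟨trivial, h.1, h.2⟩⟩
  rw [hiff]
  refine ⟨fun ⟨hq, hπ⟩ Y hY => ?_, fun h => ⟨S.eq_of_forall_form fun C => ?_, S.coisotropic X h⟩⟩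
  · rw [S.form_eq, hq, hπ, hY]
    simp
  · rw [form_coe_q_coe, h _ (S.π_coe C)]
    simp

end IsotropicSplitting

/-- `h ⊆ h^⊥`, and both have dimension `n`. -/
theorem mem_of_forall_form_eq_zero {n : ℕ} (hsig : HasSignature B.form n n) {h : Submodule ℝ g}
    (hdim : Module.finrank ℝ h = n) (hiso : IsIsotropic B.form h) {X : g}
    (hX : ∀ Y ∈ h, B.form X Y = 0) : X ∈ h := by
  have hle : h ≤ B.form.orthogonal h := fun x hx y hy => hiso y hy x hx
  have heq : h = B.form.orthogonal h := by
    refine Submodule.eq_of_le_of_finrank_eq hle ?_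
    rw [LinearMap.BilinForm.finrank_orthogonal B.nondegenerate, hsig.finrank_eq, hdim]
    omega
  rw [heq]
  intro Y hY
  rw [← hX Y hY]
  exact form_comm B Y X

end Adapted

/-! ### The balanced model of a Manin pair -/

theorem exists_balanced_model {g : Type w} [LieRing g] [LieAlgebra ℝ g] [FiniteDimensional ℝ g]
    (B : MetricStructure g) (h : Submodule ℝ g) (hM : IsManinPair B h)
    (hg : HasNoSimpleIdeals g) :
    ∃ (l : Type w) (_ : LieRing l) (_ : LieAlgebra ℝ l) (_ : FiniteDimensional ℝ l)
      (a : Type w) (_ : AddCommGroup a) (_ : Module ℝ a) (_ : LieRingModule l a)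
      (_ : LieModule ℝ l a)
      (Q : InvariantInnerProduct l a) (m : ℕ) (c : QuadraticCocycle Q)
      (l' : LieSubalgebra ℝ l) (a' : Submodule ℝ a),
      HasSignature Q.form m m ∧
      Module.finrank ℝ a' = m ∧
      IsIsotropic Q.form a' ∧
      (∀ x ∈ l', ∀ y ∈ a', ⁅x, y⁆ ∈ a') ∧
      (∀ x ∈ l', ∀ y ∈ l', c.α x y ∈ a') ∧
      (∀ x ∈ l', ∀ y ∈ l', ∀ z ∈ l', c.γ x y z = 0) ∧
      c.IsBalanced ∧
      IsIsomorphicPair B h c.modelMetric (c.maninSubspace l'.toSubmodule a') := by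
  obtain ⟨n, hsig, hlie, hdim, hiso⟩ := hM
  have hmax : ∀ X, (∀ Y ∈ h, B.form X Y = 0) → X ∈ h := fun X =>
    mem_of_forall_form_eq_zero hsig hdim hiso
  set P : LieIdeal ℝ g := perp B (canonicalIdeal B) with hP
  have hfd : FiniteDimensional ℝ (g ⧸ P) :=
    inferInstanceAs (FiniteDimensional ℝ (g ⧸ P.toSubmodule))
  have hperp : ∀ X, (∀ Y, quotientMap P Y = 0 → B.form X Y = 0) ↔ X ∈ canonicalIdeal B := by
    intro X
    rw [← perp_perp (Q := B) (canonicalIdeal B), mem_perp]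
    exact forall_congr' fun Y => by rw [quotientMap_eq_zero, form_comm]
  obtain ⟨S, hSπ, hs⟩ := exists_isotropicSplitting (B := B) (quotientMap P)
    (LieSubmodule.Quotient.surjective_mk' P)
    (fun X hX => quotientMap_eq_zero.2 (canonicalIdeal_le_perp ((hperp X).1 hX)))
    (fun X Y W hX hY hW => (hperp _).2
      (lie_mem_canonicalIdeal hg (quotientMap_eq_zero.1 hX) (quotientMap_eq_zero.1 hY)) W hW)
    hiso hmax
  rw [← hSπ] at hs hperp
  let l' : LieSubalgebra ℝ (g ⧸ P) :=
    { h.map (S.π : g →ₗ[ℝ] g ⧸ P) with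
      lie_mem' := by
        rintro _ _ ⟨x, hx, rfl⟩ ⟨y, hy, rfl⟩
        exact ⟨⁅x, y⁆, hlie x hx y hy, LieHom.map_lie _ _ _⟩ }
  have hl' : ∀ x ∈ l', S.s x ∈ h := by
    rintro _ ⟨x, hx, rfl⟩
    exact hs x hx
  let a' : Submodule ℝ S.modSpace := h.comap S.modSpace.subtype
  have ha' : IsIsotropic S.inner.form a' := fun x hx y hy => hiso _ hx _ hy
  have hmap : h.map (S.equiv : g →ₗ[ℝ] S.cocycle.Model) =
      S.cocycle.maninSubspace l'.toSubmodule a' := S.map_equiv hiso hmax hs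
  -- Counting dimensions in `h` and in `g` gives `dim a = 2 dim a'`, as the signature of `a`
  -- requires.
  have hdim₁ : Module.finrank ℝ (g ⧸ P) + Module.finrank ℝ a' = n := by
    rw [← S.cocycle.finrank_maninSubspace l'.toSubmodule a', ← hmap, ← hdim]
    exact LinearEquiv.finrank_map_eq S.equiv.toLinearEquiv h
  have hdim₂ : 2 * Module.finrank ℝ (g ⧸ P) + Module.finrank ℝ S.modSpace = n + n := by
    rw [← S.cocycle.finrank_model, ← hsig.finrank_eq]
    exact S.equiv.toLinearEquiv.finrank_eq.symm
  refine ⟨g ⧸ P, inferInstance, inferInstance, hfd, S.modSpace, inferInstance, inferInstance,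
    inferInstance, inferInstance, S.inner, Module.finrank ℝ a', S.cocycle, l', a', ?_, rfl, ha',
    fun x hx y hy => ?_, fun x hx y hy => ?_, fun x hx y hy z hz => ?_, ?_,
    S.equiv, S.form_equiv, hmap⟩
  · exact hasSignature_of_isIsotropic S.inner.symm S.inner.nondegenerate ha' rfl (by omega)
  · exact S.q_mem hiso hmax hs (hlie _ (hl' x hx) _ hy)
  · exact S.q_mem hiso hmax hs (hlie _ (hl' x hx) _ (hl' y hy))
  · exact hiso _ (hlie _ (hl' x hx) _ (hl' y hy)) _ (hl' z hz)
  -- The canonical ideal is transported by the isometry, and `l*` corresponds to `(ker π)^⊥ = i^⊥⊥ =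
  -- i`.
  · rw [QuadraticCocycle.IsBalanced, ← map_canonicalIsotropicIdeal S.equiv S.form_equiv,
      ← canonicalIdeal_toSubmodule]
    refine le_antisymm (fun Y hY => ?_) ?_
    · obtain ⟨X, rfl⟩ := S.equiv.surjective Y
      exact ⟨X, (hperp X).1 (S.equiv_mem_dualIdeal.1 hY), rfl⟩
    · rintro _ ⟨X, hX, rfl⟩
      exact S.equiv_mem_dualIdeal.2 ((hperp X).2 hX)

end QuadExt

end

open QuadExt in
theorem mainTheorem10 :
    (∀ (l : Type u) [LieRing l] [LieAlgebra ℝ l] [FiniteDimensional ℝ l]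
      (a : Type v) [AddCommGroup a] [Module ℝ a] [LieRingModule l a] [LieModule ℝ l a]
      (Q : InvariantInnerProduct l a) (m : ℕ) (c : QuadraticCocycle Q)
      (l' : LieSubalgebra ℝ l) (a' : Submodule ℝ a),
      HasSignature Q.form m m →
      Module.finrank ℝ a' = m →
      IsIsotropic Q.form a' →
      (∀ x ∈ l', ∀ y ∈ a', ⁅x, y⁆ ∈ a') →
      (∀ x ∈ l', ∀ y ∈ l', c.α x y ∈ a') →
      (∀ x ∈ l', ∀ y ∈ l', ∀ z ∈ l', c.γ x y z = 0) →
      HasSignature c.modelMetric.form (m + Module.finrank ℝ l) (m + Module.finrank ℝ l) ∧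
      IsManinPair c.modelMetric (c.maninSubspace l'.toSubmodule a')) ∧
    (∀ (g : Type w) [LieRing g] [LieAlgebra ℝ g] [FiniteDimensional ℝ g]
      (B : MetricStructure g) (h : Submodule ℝ g),
      IsManinPair B h →
      HasNoSimpleIdeals g →
      ∃ (l : Type w) (_ : LieRing l) (_ : LieAlgebra ℝ l) (_ : FiniteDimensional ℝ l)
        (a : Type w) (_ : AddCommGroup a) (_ : Module ℝ a) (_ : LieRingModule l a)
        (_ : LieModule ℝ l a)
        (Q : InvariantInnerProduct l a) (m : ℕ) (c : QuadraticCocycle Q)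
        (l' : LieSubalgebra ℝ l) (a' : Submodule ℝ a),
        HasSignature Q.form m m ∧
        Module.finrank ℝ a' = m ∧
        IsIsotropic Q.form a' ∧
        (∀ x ∈ l', ∀ y ∈ a', ⁅x, y⁆ ∈ a') ∧
        (∀ x ∈ l', ∀ y ∈ l', c.α x y ∈ a') ∧
        (∀ x ∈ l', ∀ y ∈ l', ∀ z ∈ l', c.γ x y z = 0) ∧
        c.IsBalanced ∧
        IsIsomorphicPair B h c.modelMetric (c.maninSubspace l'.toSubmodule a')) :=
  ⟨fun _ _ _ _ _ _ _ _ _ _ m c l' a' hQ hm ha hla hα hγ =>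
    hasSignature_modelMetric_and_isManinPair c m l' a' hQ hm ha hla hα hγ,
    fun _ _ _ _ B h hM hg => exists_balanced_model B h hM hg⟩
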